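/- Let $M$ be a non-empty finite-dimensional $C^\infty$ Riemannian manifold (Hausdorff, $\sigma$-compact, not necessarily compact, possibly with boundary or corners). A \emph{region} in $M$ is the closure of a non-empty connected open subset of $M$, and $B \Subset A$ means that $B$ is contained in the interior of $A$. For a smooth embedding $e\colon M\to\mathbb{R}^N$ put $$\mathrm{dist}_{C^1}^{e}(f,g) := \sup_{x\in M} |e(f(x))-e(g(x))| + \sup_{x\in M}\|D(e\circ f)(x)-D(e\circ g)(x)\| \in [0,\infty],$$ where the operator norm is taken with respect to the Riemannian norm on $T_xM$ and the Euclidean norm on $\mathbb{R}^N$. There exists a compact region $\hat A\subset M$ such that for every $N$, every smooth embedding $e\colon M\to\mathbb{R}^N$ and every $\varepsilon>0$ there exists a $C^\infty$-smooth arc of diffeomorphisms $\tilde f_t\colon M\to M$, $t\in[0,1]$ (each $\tilde f_t$ is a $C^\infty$ diffeomorphism of $M$ onto itself, and $(t,x)\mapsto\tilde f_t(x)$ is $C^\infty$ on $[0,1]\times M$), such that 1. $\tilde f_t(\hat A)\Subset\hat A$ for all $t\in[0,1]$; 2. $\|D\tilde f_t(x)\|<1$ for all $t\in[0,1]$ and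 all $x\in\hat A$, in the operator norm defined by the Riemannian metric; 3. $\mathrm{dist}_{C^1}^{e}(\tilde f_t,\mathrm{Id})<\varepsilon$ for all $t\in[0,1]$; 4. there exists a region $A\Subset\hat A$ such that $A\Subset\tilde f_0(A)\cup\tilde f_1(A)$. -/

import Mathlib

open Set Bundle Manifold
open scoped Manifold ContDiff Topology ENNReal

/-- A region of `X` is the closure of a non-empty connected open subset of `X`
(`IsConnected` includes non-emptiness). -/
def IsRegion {X : Type*} [TopologicalSpace X] (S : Set X) : Prop :=
  ∃ U : Set X, IsOpen U ∧ IsConnected U ∧ S = closure U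

/-- `StrictlyInside B A` is the relation `B ⋐ A`: the interior of `A` contains `B`. -/
def StrictlyInside {X : Type*} [TopologicalSpace X] (B A : Set X) : Prop :=
  B ⊆ interior A

/-- A smooth embedding of a manifold `M` into the Euclidean space `ℝ^N`: a smooth map that is a
topological embedding and has injective differentials. -/
structure IsEuclideanEmbedding {E : Type*} [NormedAddCommGroup E] [NormedSpace ℝ E]
    {H : Type*} [TopologicalSpace H] (I : ModelWithCorners ℝ E H)
    {M : Type*} [TopologicalSpace M] [ChartedSpace H M]
    {N : ℕ} (e : M → EuclideanSpace ℝ (Fin N)) : Prop where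
  contMDiff : ContMDiff I 𝓘(ℝ, EuclideanSpace ℝ (Fin N)) ∞ e
  isEmbedding : Topology.IsEmbedding e
  injective_mfderiv : ∀ x : M,
    Function.Injective (mfderiv I 𝓘(ℝ, EuclideanSpace ℝ (Fin N)) e x)

/-- The differential at `x` of a map from a manifold to a Euclidean space, as a continuous linear
map from the tangent space at `x` to that Euclidean space. -/
noncomputable def euclideanDifferential {E : Type*} [NormedAddCommGroup E] [NormedSpace ℝ E]
    {H : Type*} [TopologicalSpace H] (I : ModelWithCorners ℝ E H)
    {M : Type*} [TopologicalSpace M] [ChartedSpace H M]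
    {N : ℕ} (u : M → EuclideanSpace ℝ (Fin N)) (x : M) :
    TangentSpace I x →L[ℝ] EuclideanSpace ℝ (Fin N) :=
  mfderiv I 𝓘(ℝ, EuclideanSpace ℝ (Fin N)) u x

/-- The `C^1` distance between two maps `f, g : M → M` of a Riemannian manifold `M`, measured
through an embedding `e` of `M` into a Euclidean space:
`sup_x |e (f x) - e (g x)| + sup_x ‖D(e ∘ f)(x) - D(e ∘ g)(x)‖`, where the operator norm is taken
with respect to the Riemannian norm on the tangent space of `M` at `x`. It takes values in `[0, ∞]`. -/
noncomputable def c1Dist {E : Type*} [NormedAddCommGroup E] [NormedSpace ℝ E]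
    {H : Type*} [TopologicalSpace H] (I : ModelWithCorners ℝ E H)
    {M : Type*} [TopologicalSpace M] [ChartedSpace H M]
    [RiemannianBundle (fun x : M => TangentSpace I x)]
    {N : ℕ} (e : M → EuclideanSpace ℝ (Fin N)) (f g : M → M) : ℝ≥0∞ :=
  (⨆ x : M, ENNReal.ofReal ‖e (f x) - e (g x)‖) +
    ⨆ x : M, ENNReal.ofReal
      ‖euclideanDifferential I (e ∘ f) x - euclideanDifferential I (e ∘ g) x‖

/-!
In dimension at least two, two smaller homothetic copies of a convex body never cover it, so
homotheties of a ball do not suffice. The two extreme maps are taken of the form `z ↦ D z ± v`,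
where `D` is the diagonal matrix with entries `exp (-τ), …, exp (-n τ)` and `τ` is small.

A set covered by its two images under `z ↦ D z ± v` is a set that the expanding system
`x i ↦ μ i * x i ± 1`, with `μ i = exp (i τ)`, leaves invariant for some choice of the signs, up to
scaling. The diagonal system is a quotient of a scalar linear recurrence
`y (j + L) = ∑ i < L, h i * y (j + i) ± 1` as soon as the `μ i` are roots of
`X ^ L - ∑ i < L, h i * X ^ i`; if moreover `∑ |h i| < 2`, choosing the sign opposite to that of the
linear term keeps `y` bounded, so that a box of windows of length `L` is carried into its interior.
The set is the linear image of this box (`exists_region_expanding_control`). A recurrence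
with `∑ |h i| ≤ 3 / 2` comes from interpolation: for `τ = 1 / s` and `L = s n + 1`, the
relation is sought with exponents that are multiples of `s`, and says that `exp (x (n + τ))` is a
combination of `exp x, …, exp (n x)` at `x = 1, …, n`. As `s → ∞` the coefficients tend to
`(0, …, 0, 1)`, of `ℓ¹` norm one (`eventually_exists_extrapolation`).

These affine maps are within `O(τ)` of the identity, so they can be cut off to diffeomorphisms of
`ℝ ^ n` with compact support, close to the identity in `C¹`, the two signs being joined by
`z ↦ D z + θ • v` with `θ ∈ [-1, 1]` (`nonempty_contractingFamily`). They are
transplanted to `M` by a chart at an interior point in which the metric at the centre is Euclidean.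
On a ball of radius `r` about the centre the contraction gains at least `τ / 2`, whereas the
variation of the metric costs at most a constant times `r τ`, since points of the ball move by
`O(r τ)`. A small `r`, fixed before `τ`, thus yields strict contraction for the Riemannian metric
(`norm_map_sub_sq_le`), and the ball itself is the required compact region.
-/

/-! ### Signed control of expanding diagonal systems -/

/-- For `τ → 0` the exponential `exp (x (n + τ))` is interpolated at the nodes `x = 1, …, n` by a
combination of `exp x, exp (2 x), …, exp (n x)`, the coefficients of which converge to those of the
last exponential, namely `(0, …, 0, 1)`. In particular their `ℓ¹` norm is eventually at most
`3 / 2`; all that matters later is that this bound is smaller than `2`. -/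
lemma eventually_exists_extrapolation (n : ℕ) :
    ∀ᶠ τ in 𝓝 (0 : ℝ), ∃ a : Fin n → ℝ, ∑ j, |a j| ≤ 3 / 2 ∧
      ∀ i : Fin n, Real.exp (((i : ℕ) + 1 : ℝ) * (n + τ)) =
        ∑ j : Fin n, a j * Real.exp (((i : ℕ) + 1 : ℝ) * ((j : ℕ) + 1)) := by
  set x : Fin n → ℝ := fun i => Real.exp ((i : ℕ) + 1 : ℝ) with hx
  set W : Matrix (Fin n) (Fin n) ℝ :=
    Matrix.of fun i j => Real.exp (((i : ℕ) + 1 : ℝ) * ((j : ℕ) + 1)) with hW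
  have hWx : W = Matrix.diagonal x * Matrix.vandermonde x := by
    ext i j
    rw [Matrix.diagonal_mul, Matrix.vandermonde_apply, hW, hx]
    simp only [Matrix.of_apply]
    rw [← Real.exp_nat_mul, ← Real.exp_add]
    congr 1
    ring
  have hdet : IsUnit W.det := by
    rw [isUnit_iff_ne_zero, hWx, Matrix.det_mul, Matrix.det_diagonal]
    refine mul_ne_zero (Finset.prod_ne_zero_iff.2 fun i _ => (Real.exp_pos _).ne') ?_
    refine Matrix.det_vandermonde_ne_zero_iff.2 fun i j hij => ?_
    have := Real.exp_injective hij
    exact Fin.ext (by exact_mod_cast add_right_cancel this)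
  set g : ℝ → Fin n → ℝ := fun τ i => Real.exp (((i : ℕ) + 1 : ℝ) * (n + τ)) with hg
  have hg0 : W⁻¹.mulVec (g 0) = fun j : Fin n => if (j : ℕ) + 1 = n then 1 else 0 := by
    have : g 0 = W.mulVec (fun j : Fin n => if (j : ℕ) + 1 = n then 1 else 0) := by
      ext i
      obtain ⟨k, rfl⟩ : ∃ k, n = k + 1 := ⟨n - 1, by have := i.2; omega⟩
      rw [Matrix.mulVec, dotProduct, Finset.sum_eq_single (Fin.last k)]
      · simp [hg, hW]
      · intro b _ hb
        have : (b : ℕ) ≠ k := fun h => hb (Fin.ext h)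
        simp [this]
      · simp
    rw [this, Matrix.mulVec_mulVec, Matrix.nonsing_inv_mul _ hdet, Matrix.one_mulVec]
  have hcont : Continuous fun τ => ∑ j, |(W⁻¹.mulVec (g τ)) j| := by
    simp only [Matrix.mulVec, dotProduct, hg]
    fun_prop
  have h0 : ∑ j, |(W⁻¹.mulVec (g 0)) j| < 3 / 2 := by
    rw [hg0]
    rcases n with _ | k
    · simp
    · rw [Finset.sum_eq_single (Fin.last k)]
      · norm_num
      · intro b _ hb
        have : (b : ℕ) ≠ k := fun h => hb (Fin.ext h)
        simp [this]
      · simp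
  filter_upwards [hcont.continuousAt.eventually_lt continuousAt_const h0] with τ hτ
  refine ⟨W⁻¹.mulVec (g τ), hτ.le, fun i => ?_⟩
  have : W.mulVec (W⁻¹.mulVec (g τ)) i = g τ i := by
    rw [Matrix.mulVec_mulVec, Matrix.mul_nonsing_inv _ hdet, Matrix.one_mulVec]
  rw [Matrix.mulVec, dotProduct] at this
  change g τ i = _
  rw [← this]
  exact Finset.sum_congr rfl fun j _ => mul_comm _ _

/-- The value at `μ` of the polynomial part of `(X ^ L - ∑ i < L, h i * X ^ i) / X ^ j`, that is
`μ ^ (L - j) - ∑ i ∈ [j, L), h i * μ ^ (i - j)`: the `j`-th Horner coefficient in the division of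
`X ^ L - ∑ i < L, h i * X ^ i` by `X - μ`. -/
noncomputable def polyTail (h : ℕ → ℝ) (L : ℕ) (μ : ℝ) (j : ℕ) : ℝ :=
  μ ^ (L - j) - ∑ i ∈ Finset.Ico j L, h i * μ ^ (i - j)

lemma polyTail_self (h : ℕ → ℝ) (L : ℕ) (μ : ℝ) : polyTail h L μ L = 1 := by
  simp [polyTail]

lemma mul_polyTail_succ (h : ℕ → ℝ) {L j : ℕ} (μ : ℝ) (hj : j < L) :
    μ * polyTail h L μ (j + 1) = polyTail h L μ j + h j := by
  unfold polyTail
  rw [Finset.sum_eq_sum_Ico_succ_bot hj, mul_sub, Finset.mul_sum]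
  have h1 : μ * μ ^ (L - (j + 1)) = μ ^ (L - j) := by
    rw [← pow_succ']; congr 1; omega
  have h2 : ∑ i ∈ Finset.Ico (j + 1) L, μ * (h i * μ ^ (i - (j + 1))) =
      ∑ i ∈ Finset.Ico (j + 1) L, h i * μ ^ (i - j) := by
    refine Finset.sum_congr rfl fun i hi => ?_
    have := (Finset.mem_Ico.1 hi).1
    rw [show i - j = (i - (j + 1)) + 1 by omega, pow_succ]; ring
  rw [h1, h2, Nat.sub_self, pow_zero]
  ring

lemma polyTail_zero (h : ℕ → ℝ) {L : ℕ} {μ : ℝ} (hμ : μ ^ L = ∑ j ∈ Finset.range L, h j * μ ^ j) :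
    polyTail h L μ 0 = 0 := by
  rw [polyTail, Nat.sub_zero, hμ, Finset.range_eq_Ico]
  simp only [Nat.sub_zero, sub_self]

/-- The linear map that takes a window `(y 0, …, y m)` of a solution of the recurrence
`y (j + m + 1) = ∑ i ≤ m, h i * y (j + i) + σ j` to a point of `ℝ ^ n`. When every `μ i` is a root
of the characteristic polynomial of the recurrence, shifting the window corresponds to the diagonal
system `x i ↦ μ i * x i + σ`, see `windowMap_shift`. -/
noncomputable def windowMap {n : ℕ} (h : ℕ → ℝ) (m : ℕ) (μ : Fin n → ℝ) :
    (Fin (m + 1) → ℝ) →ₗ[ℝ] EuclideanSpace ℝ (Fin n) where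
  toFun y := WithLp.toLp 2 fun i => ∑ j : Fin (m + 1), y j * polyTail h (m + 1) (μ i) (j + 1)
  map_add' y z := by
    ext i; simp [add_mul, Finset.sum_add_distrib]
  map_smul' c y := by
    ext i; simp [Finset.mul_sum, mul_assoc]

lemma windowMap_apply {n : ℕ} (h : ℕ → ℝ) (m : ℕ) (μ : Fin n → ℝ) (y : Fin (m + 1) → ℝ)
    (i : Fin n) :
    windowMap h m μ y i = ∑ j : Fin (m + 1), y j * polyTail h (m + 1) (μ i) (j + 1) := rfl

lemma windowMap_shift {n : ℕ} {h : ℕ → ℝ} {m : ℕ} {μ : Fin n → ℝ}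
    (hμ : ∀ i, μ i ^ (m + 1) = ∑ j ∈ Finset.range (m + 1), h j * μ i ^ j)
    (y : Fin (m + 1) → ℝ) (σ : ℝ) (i : Fin n) :
    windowMap h m μ (Fin.snoc (α := fun _ => ℝ) (Fin.tail y) (∑ j : Fin (m + 1), h j * y j + σ)) i =
      μ i * windowMap h m μ y i + σ := by
  have e1 : μ i * windowMap h m μ y i =
      ∑ j : Fin (m + 1), y j * polyTail h (m + 1) (μ i) j + ∑ j : Fin (m + 1), h j * y j := by
    rw [windowMap_apply, Finset.mul_sum, ← Finset.sum_add_distrib]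
    refine Finset.sum_congr rfl fun j _ => ?_
    rw [mul_left_comm, mul_polyTail_succ h (μ i) j.2]; ring
  rw [e1, windowMap_apply, Fin.sum_univ_castSucc, Fin.sum_univ_succ (fun j : Fin (m + 1) =>
    y j * polyTail h (m + 1) (μ i) j)]
  simp only [Fin.snoc_castSucc, Fin.snoc_last, Fin.val_zero, polyTail_zero h (hμ i), Fin.val_last,
    polyTail_self, Fin.val_castSucc, Fin.val_succ, Fin.tail]
  ring

/-- The range contains `(1, …, 1)` and, by `windowMap_shift` without forcing, is stable under
`diag μ`; as the `μ i` are distinct, Lagrange interpolation shows that it is everything. -/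
lemma windowMap_surjective {n : ℕ} {h : ℕ → ℝ} {m : ℕ} {μ : Fin n → ℝ}
    (hinj : Function.Injective μ)
    (hμ : ∀ i, μ i ^ (m + 1) = ∑ j ∈ Finset.range (m + 1), h j * μ i ^ j) :
    Function.Surjective (windowMap h m μ) := by
  have hpow : ∀ k : ℕ, ∃ y, ∀ i, windowMap h m μ y i = μ i ^ k := by
    intro k
    induction k with
    | zero =>
      refine ⟨Pi.single (Fin.last m) 1, fun i => ?_⟩
      rw [windowMap_apply, Finset.sum_eq_single (Fin.last m)]
      · simp [polyTail_self]
      · intro b _ hb; simp [hb]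
      · simp
    | succ k ih =>
      obtain ⟨y, hy⟩ := ih
      exact ⟨_, fun i => by rw [windowMap_shift hμ y 0 i, hy, add_zero, pow_succ']⟩
  choose Y hY using hpow
  intro x
  set q := Lagrange.interpolate Finset.univ μ (fun i => x i) with hq
  refine ⟨∑ k ∈ Finset.range (q.natDegree + 1), q.coeff k • Y k, ?_⟩
  ext i
  have : q.eval (μ i) = x i :=
    Lagrange.eval_interpolate_at_node _ hinj.injOn (Finset.mem_univ i)
  rw [← this, Polynomial.eval_eq_sum_range, map_sum, WithLp.ofLp_sum, Finset.sum_apply]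
  refine Finset.sum_congr rfl fun k _ => ?_
  rw [map_smul, PiLp.smul_apply, hY, smul_eq_mul]

lemma exists_sign_abs_add_lt {s : ℝ} (hs : |s| ≤ 12 / 5) :
    ∃ σ : ℝ, (σ = 1 ∨ σ = -1) ∧ |s + σ| < 3 / 2 := by
  rw [abs_le] at hs
  rcases le_total s 0 with h | h
  · exact ⟨1, Or.inl rfl, by rw [abs_lt]; constructor <;> linarith⟩
  · exact ⟨-1, Or.inr rfl, by rw [abs_lt]; constructor <;> linarith⟩

/-- The expanding diagonal system `x i ↦ μ i * x i + σ` with control `σ = ±1` has a bounded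
open set `U` such that each point of `closure U` is mapped into `U` by one of the two controls. The
set is the image under `windowMap` of a box: the recurrence with coefficients of
`ℓ¹` norm at most `3 / 2` keeps its windows bounded once the sign of the forcing is opposed to that
of the linear term. -/
lemma exists_region_expanding_control {n m : ℕ} {h : ℕ → ℝ} {μ : Fin n → ℝ}
    (hinj : Function.Injective μ)
    (hh : ∑ j ∈ Finset.range (m + 1), |h j| ≤ 3 / 2)
    (hμ : ∀ i, μ i ^ (m + 1) = ∑ j ∈ Finset.range (m + 1), h j * μ i ^ j) :
    ∃ U : Set (EuclideanSpace ℝ (Fin n)), IsOpen U ∧ IsConnected U ∧ Bornology.IsBounded U ∧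
      ∀ x ∈ closure U, ∃ y ∈ U, ∃ σ : ℝ, (σ = 1 ∨ σ = -1) ∧ ∀ i, y i = μ i * x i + σ := by
  set P := windowMap h m μ with hP
  have hPc : Continuous P := LinearMap.continuous_of_finiteDimensional P
  -- The radii of the box decrease with `j`, so that a shifted window lies strictly inside.
  set Y : ℕ → ℝ := fun j => 8 / 5 - j / (10 * (m + 1)) with hY
  have hm : (0 : ℝ) < 10 * (m + 1) := by positivity
  have hYlt : ∀ j, Y (j + 1) < Y j := fun j => by
    simp only [hY]; push_cast
    have : (j : ℝ) / (10 * (m + 1)) < (j + 1) / (10 * (m + 1)) := by gcongr; linarith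
    linarith
  have hYle : ∀ j, Y j ≤ 8 / 5 := fun j => by
    have : (0 : ℝ) ≤ j / (10 * (m + 1)) := by positivity
    simp only [hY]; linarith
  have hYge : ∀ j ≤ m, 3 / 2 ≤ Y j := fun j hj => by
    have : (j : ℝ) / (10 * (m + 1)) ≤ 1 / 10 := by
      rw [div_le_iff₀ hm]
      have : (j : ℝ) ≤ m := by exact_mod_cast hj
      linarith
    simp only [hY]; linarith
  set Q : Set (Fin (m + 1) → ℝ) := Set.pi univ fun j => Ioo (-Y j) (Y j) with hQ
  set K : Set (Fin (m + 1) → ℝ) := Set.pi univ fun j => Icc (-Y j) (Y j) with hK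
  have hKc : IsCompact K := isCompact_univ_pi fun j => isCompact_Icc
  have hQK : Q ⊆ K := Set.pi_mono fun j _ => Ioo_subset_Icc_self
  have hcl : closure (P '' Q) ⊆ P '' K :=
    closure_minimal (image_mono hQK) (hKc.image hPc).isClosed
  refine ⟨P '' Q, ?_, ?_, ?_, ?_⟩
  · exact P.isOpenMap_of_finiteDimensional (windowMap_surjective hinj hμ) _
      (isOpen_set_pi finite_univ fun j _ => isOpen_Ioo)
  · refine ⟨⟨P 0, 0, fun j _ => ?_, rfl⟩, ?_⟩
    · have := hYge j (by have := j.2; omega)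
      simp only [Pi.zero_apply, mem_Ioo]
      constructor <;> linarith
    · exact ((convex_pi fun j _ => convex_Ioo _ _).linear_image P).isPreconnected
  · exact (hKc.image hPc).isBounded.subset (image_mono hQK)
  · intro x hx
    obtain ⟨y, hy, rfl⟩ := hcl hx
    have hyabs : ∀ j : Fin (m + 1), |y j| ≤ Y j := fun j => abs_le.2 (hy j (mem_univ _))
    have hs : |∑ j : Fin (m + 1), h j * y j| ≤ 12 / 5 := by
      calc |∑ j : Fin (m + 1), h j * y j| ≤ ∑ j : Fin (m + 1), |h j * y j| :=
            Finset.abs_sum_le_sum_abs _ _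
        _ ≤ ∑ j : Fin (m + 1), |h j| * (8 / 5) := by
            refine Finset.sum_le_sum fun j _ => ?_
            rw [abs_mul]
            exact mul_le_mul_of_nonneg_left ((hyabs j).trans (hYle j)) (abs_nonneg _)
        _ ≤ 12 / 5 := by
            rw [← Finset.sum_mul, Fin.sum_univ_eq_sum_range (fun j => |h j|)]
            linarith
    obtain ⟨σ, hσ, hlt⟩ := exists_sign_abs_add_lt hs
    refine ⟨_, ⟨Fin.snoc (α := fun _ => ℝ) (Fin.tail y) (∑ j : Fin (m + 1), h j * y j + σ), ?_, rfl⟩,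
      σ, hσ, fun i => windowMap_shift hμ y σ i⟩
    intro j _
    rw [mem_Ioo, ← abs_lt]
    refine Fin.lastCases ?_ (fun j => ?_) j
    · rw [Fin.snoc_last]
      exact hlt.trans_le (hYge _ (by simp))
    · rw [Fin.snoc_castSucc]
      exact (hyabs j.succ).trans_lt (by simpa using hYlt j)

/-- The diagonal contraction of `ℝ ^ n` with entries `exp (-τ), exp (-2 τ), …, exp (-n τ)`. -/
noncomputable def expDiag (n : ℕ) (τ : ℝ) :
    EuclideanSpace ℝ (Fin n) →L[ℝ] EuclideanSpace ℝ (Fin n) :=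
  LinearMap.toContinuousLinearMap
    { toFun := fun x => WithLp.toLp 2 fun i => Real.exp (-(((i : ℕ) + 1) * τ)) * x i
      map_add' := fun x y => by ext i; simp [mul_add]
      map_smul' := fun c x => by ext i; simp; ring }

lemma expDiag_apply (n : ℕ) (τ : ℝ) (x : EuclideanSpace ℝ (Fin n)) (i : Fin n) :
    expDiag n τ x i = Real.exp (-(((i : ℕ) + 1) * τ)) * x i := rfl

open scoped Pointwise in
/-- For small `τ` of the form `1 / s`, the two affine contractions `y ↦ expDiag n τ y ± v` cover the
closure of a bounded connected open set `U` by their images of `U`, with `U` and `v` as small as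
desired. -/
lemma eventually_exists_covering (n : ℕ) :
    ∀ᶠ s : ℕ in Filter.atTop, ∀ ρ > 0, ∃ v : EuclideanSpace ℝ (Fin n), ‖v‖ ≤ ρ ∧
      ∃ U : Set (EuclideanSpace ℝ (Fin n)), IsOpen U ∧ IsConnected U ∧
        U ⊆ Metric.ball 0 ρ ∧ ∀ x ∈ closure U, ∃ y ∈ U,
          x = expDiag n (1 / s) y + v ∨ x = expDiag n (1 / s) y - v := by
  filter_upwards [tendsto_one_div_atTop_nhds_zero_nat.eventually
    (eventually_exists_extrapolation n), Filter.eventually_gt_atTop 0] with s hs hs0 ρ hρ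
  obtain ⟨a, ha, hae⟩ := hs
  have hs0' : (s : ℝ) ≠ 0 := by positivity
  set μ : Fin n → ℝ := fun i => Real.exp (((i : ℕ) + 1) * (1 / s)) with hμd
  -- The `μ i` are roots of `X ^ (s n + 1) - ∑ j, a j * X ^ (s (j + 1))`, which is the relation of
  -- `eventually_exists_extrapolation` at `τ = 1 / s` after the substitution `X ^ s = exp x`.
  set h : ℕ → ℝ := fun k => ∑ j : Fin n, if k = s * (j + 1) then a j else 0 with hhd
  have hlt : ∀ j : Fin n, s * ((j : ℕ) + 1) ∈ Finset.range (s * n + 1) := fun j => by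
    rw [Finset.mem_range]
    have : s * ((j : ℕ) + 1) ≤ s * n := Nat.mul_le_mul_left _ j.2
    omega
  have hinj : Function.Injective μ := fun i j hij => by
    have := Real.exp_injective hij
    have := mul_right_cancel₀ (by positivity) this
    exact Fin.ext (by exact_mod_cast add_right_cancel this)
  have hh : ∑ k ∈ Finset.range (s * n + 1), |h k| ≤ 3 / 2 := by
    calc ∑ k ∈ Finset.range (s * n + 1), |h k|
        ≤ ∑ k ∈ Finset.range (s * n + 1), ∑ j : Fin n, if k = s * (j + 1) then |a j| else 0 := by
          refine Finset.sum_le_sum fun k _ => (Finset.abs_sum_le_sum_abs _ _).trans_eq ?_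
          refine Finset.sum_congr rfl fun j _ => ?_
          split_ifs <;> simp
      _ = ∑ j, |a j| := by
          rw [Finset.sum_comm]
          refine Finset.sum_congr rfl fun j _ => ?_
          rw [Finset.sum_ite_eq' _ _ _, if_pos (hlt j)]
      _ ≤ 3 / 2 := ha
  have hμ : ∀ i, μ i ^ (s * n + 1) = ∑ k ∈ Finset.range (s * n + 1), h k * μ i ^ k := by
    intro i
    have e1 : μ i ^ (s * n + 1) = Real.exp (((i : ℕ) + 1 : ℝ) * (n + 1 / s)) := by
      rw [hμd, ← Real.exp_nat_mul]
      congr 1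
      push_cast
      field_simp
    have e2 : ∀ j : Fin n, μ i ^ (s * ((j : ℕ) + 1)) =
        Real.exp (((i : ℕ) + 1 : ℝ) * ((j : ℕ) + 1)) := fun j => by
      rw [hμd, ← Real.exp_nat_mul]
      congr 1
      push_cast
      field_simp
    rw [e1, hae i]
    simp only [hhd, Finset.sum_mul, ite_mul, zero_mul]
    rw [Finset.sum_comm]
    refine Finset.sum_congr rfl fun j _ => ?_
    rw [Finset.sum_ite_eq' _ _ _, if_pos (hlt j), e2]
  obtain ⟨U, hUo, hUc, hUb, hU⟩ := exists_region_expanding_control hinj hh hμ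
  obtain ⟨R, hR0, hR⟩ := hUb.subset_ball_lt 0 0
  set b : EuclideanSpace ℝ (Fin n) := expDiag n (1 / s) (WithLp.toLp 2 fun _ => 1) with hb
  -- Rescaling by `κ` keeps the linear part and makes both the translation and the set small.
  set κ : ℝ := ρ / (R + ‖b‖) with hκd
  have hRb : 0 < R + ‖b‖ := by positivity
  have hκ : 0 < κ := by positivity
  have hκR : κ * (R + ‖b‖) = ρ := by rw [hκd]; field_simp
  refine ⟨κ • b, ?_, κ • U, hUo.smul₀ hκ.ne', ?_, ?_, ?_⟩
  · rw [norm_smul, Real.norm_of_nonneg hκ.le]; nlinarith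
  · exact hUc.image _ (continuous_const_smul κ).continuousOn
  · rintro _ ⟨u, hu, rfl⟩
    have := hR hu
    rw [mem_ball_zero_iff] at this ⊢
    simp only [norm_smul, Real.norm_of_nonneg hκ.le]
    nlinarith [norm_nonneg b]
  · intro x hx
    rw [closure_smul₀' hκ.ne'] at hx
    obtain ⟨x, hx, rfl⟩ := hx
    obtain ⟨y, hy, σ, hσ, hyx⟩ := hU x hx
    refine ⟨κ • y, smul_mem_smul_set hy, ?_⟩
    have key : x = expDiag n (1 / s) y - σ • b := by
      ext i
      have hi : Real.exp (-(((i : ℕ) + 1) * (1 / (s : ℝ)))) * μ i = 1 := by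
        rw [hμd, ← Real.exp_add]; simp
      simp only [PiLp.sub_apply, PiLp.smul_apply, expDiag_apply, hb, hyx, smul_eq_mul]
      linear_combination (-(x i)) * hi
    rcases hσ with rfl | rfl
    · right
      simp only [map_smul]; rw [← smul_sub, ← one_smul ℝ b, ← key]
    · left
      simp only [map_smul]; rw [← smul_add, ← sub_neg_eq_add, ← neg_one_smul ℝ b, ← key]

lemma norm_expDiag_apply_le {n : ℕ} {τ : ℝ} (hτ : 0 ≤ τ) (x : EuclideanSpace ℝ (Fin n)) :
    ‖expDiag n τ x‖ ≤ ‖x‖ * Real.exp (-τ) := by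
  rw [mul_comm, EuclideanSpace.norm_eq, EuclideanSpace.norm_eq,
    ← Real.sqrt_sq (Real.exp_pos (-τ)).le, ← Real.sqrt_mul (by positivity), Finset.mul_sum]
  refine Real.sqrt_le_sqrt (Finset.sum_le_sum fun i _ => ?_)
  rw [expDiag_apply, norm_mul, mul_pow, Real.norm_of_nonneg (Real.exp_pos _).le]
  gcongr
  have : (0 : ℝ) ≤ (i : ℕ) := by positivity
  nlinarith

lemma norm_sub_expDiag_apply_le {n : ℕ} {τ : ℝ} (hτ : 0 ≤ τ) (x : EuclideanSpace ℝ (Fin n)) :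
    ‖x - expDiag n τ x‖ ≤ n * τ * ‖x‖ := by
  rw [EuclideanSpace.norm_eq, EuclideanSpace.norm_eq x,
    ← Real.sqrt_sq (show 0 ≤ n * τ by positivity), ← Real.sqrt_mul (by positivity),
    Finset.mul_sum]
  refine Real.sqrt_le_sqrt (Finset.sum_le_sum fun i _ => ?_)
  rw [PiLp.sub_apply, expDiag_apply, ← one_sub_mul, norm_mul, mul_pow]
  have h1 : ((i : ℕ) + 1 : ℝ) ≤ n := by exact_mod_cast i.2
  have h2 : ((i : ℕ) + 1 : ℝ) * τ ≤ n * τ := by gcongr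
  have h3 : Real.exp (-(((i : ℕ) + 1) * τ)) ≤ 1 := Real.exp_le_one_iff.2 (by
    have : 0 ≤ ((i : ℕ) + 1 : ℝ) * τ := by positivity
    linarith)
  have h4 := Real.add_one_le_exp (-(((i : ℕ) + 1) * τ))
  rw [Real.norm_of_nonneg (by linarith)]
  gcongr
  linarith

lemma exp_neg_le_one_sub_half {τ : ℝ} (hτ : 0 ≤ τ) (hτ1 : τ ≤ 1) :
    Real.exp (-τ) ≤ 1 - τ / 2 := by
  have h2 : 1 + τ ≤ Real.exp τ := by linarith [Real.add_one_le_exp τ]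
  rw [Real.exp_neg, inv_le_comm₀ (Real.exp_pos _) (by linarith)]
  refine le_trans ?_ h2
  rw [inv_le_iff_one_le_mul₀ (by linarith)]
  nlinarith

lemma half_mul_norm_sq_le_inner_sub_expDiag {n : ℕ} {τ : ℝ} (hτ : 0 ≤ τ) (hτ1 : τ ≤ 1)
    (x : EuclideanSpace ℝ (Fin n)) :
    τ / 2 * ‖x‖ ^ 2 ≤ inner ℝ x (x - expDiag n τ x) := by
  have h1 := exp_neg_le_one_sub_half hτ hτ1
  have h2 := real_inner_le_norm x (expDiag n τ x)
  have h3 := norm_expDiag_apply_le hτ x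
  rw [inner_sub_right, real_inner_self_eq_norm_sq]
  nlinarith [norm_nonneg x, mul_le_mul_of_nonneg_left h3 (norm_nonneg x),
    mul_le_mul_of_nonneg_left h1 (sq_nonneg ‖x‖)]

/-! ### Compactly supported perturbations of the identity -/

/-- A smooth perturbation of the identity with differential of norm at most `1 / 2` is a
diffeomorphism of `V`. -/
lemma exists_smooth_inverse_id_add {V : Type*} [NormedAddCommGroup V] [NormedSpace ℝ V]
    [CompleteSpace V] {p : V → V} (hp : ContDiff ℝ ∞ p) (hp' : ∀ z, ‖fderiv ℝ p z‖ ≤ 1 / 2) :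
    ∃ G : V → V, ContDiff ℝ ∞ G ∧ Function.LeftInverse G (fun z => z + p z) ∧
      Function.RightInverse G (fun z => z + p z) := by
  have hpd : Differentiable ℝ p := hp.differentiable (by simp)
  have hlip : LipschitzWith (1 / 2) p :=
    lipschitzWith_of_nnnorm_fderiv_le hpd fun z => by
      rw [← NNReal.coe_le_coe]; simpa using hp' z
  set F : V → V := fun z => z + p z with hF
  have happ : ApproximatesLinearOn F (ContinuousLinearEquiv.refl ℝ V : V →L[ℝ] V) univ
      (1 / 2) := by
    intro x _ y _
    have e : F x - F y - (ContinuousLinearEquiv.refl ℝ V : V →L[ℝ] V) (x - y) = p x - p y := by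
      simp only [hF, ContinuousLinearEquiv.coe_coe, ContinuousLinearEquiv.refl_apply]
      abel
    rw [e, ← dist_eq_norm, ← dist_eq_norm]
    exact hlip.dist_le_mul x y
  have hc : Subsingleton V ∨
      (1 / 2 : NNReal) < ‖((ContinuousLinearEquiv.refl ℝ V).symm : V →L[ℝ] V)‖₊⁻¹ := by
    rcases subsingleton_or_nontrivial V with h | h
    · exact Or.inl h
    · right
      have : ‖((ContinuousLinearEquiv.refl ℝ V).symm : V →L[ℝ] V)‖₊ = 1 := by
        apply NNReal.eq
        exact ContinuousLinearMap.norm_id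
      rw [this, inv_one]
      exact NNReal.half_lt_self one_ne_zero
  set e := happ.toHomeomorph F hc with he
  have hFe : ∀ z, e z = F z := fun z => rfl
  have hFc : ContDiff ℝ ∞ F := contDiff_id.add hp
  refine ⟨e.symm, ?_, fun z => e.symm_apply_apply z, fun z => e.apply_symm_apply z⟩
  have hunit : ∀ z, ∃ T : V ≃L[ℝ] V, (T : V →L[ℝ] V) = .id ℝ V + fderiv ℝ p z := fun z => by
    have hu : IsUnit (1 - (-fderiv ℝ p z)) := isUnit_one_sub_of_norm_lt_one (by
      rw [norm_neg]; exact (hp' z).trans_lt (by norm_num))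
    obtain ⟨u, hu⟩ := hu
    refine ⟨ContinuousLinearEquiv.unitsEquiv ℝ V u, ?_⟩
    ext w
    change (u : V →L[ℝ] V) w = _
    rw [hu]
    simp
  choose T hT using hunit
  refine e.contDiff_symm (f₀' := T) (fun z => ?_) hFc
  rw [hT]
  exact (hasFDerivAt_id z).add (hpd z).hasFDerivAt

lemma exists_smooth_cutoff {V : Type*} [NormedAddCommGroup V] [InnerProductSpace ℝ V]
    [FiniteDimensional ℝ V] {r : ℝ} (hr : 0 < r) :
    ∃ χ : V → ℝ, ∃ B : ℝ, ContDiff ℝ ∞ χ ∧ (∀ z, 0 ≤ χ z ∧ χ z ≤ 1) ∧ 0 ≤ B ∧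
      (∀ z, ‖fderiv ℝ χ z‖ ≤ B) ∧ (∀ z, ‖z‖ < 2 * r → χ z = 1) ∧
      (∀ z, 3 * r ≤ ‖z‖ → χ z = 0) := by
  let f : ContDiffBump (0 : V) := ⟨2 * r, 3 * r, by linarith, by linarith⟩
  have hd : Continuous (fderiv ℝ f) := (f.contDiff (n := 1)).continuous_fderiv (by simp)
  obtain ⟨B, hB⟩ := (f.hasCompactSupport.fderiv (𝕜 := ℝ)).exists_bound_of_continuous hd
  refine ⟨f, B, f.contDiff, fun z => ⟨f.nonneg, f.le_one⟩, (norm_nonneg _).trans (hB 0), hB,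
    fun z hz => f.one_of_mem_closedBall ?_, fun z hz => f.zero_of_le_dist ?_⟩
  · rw [mem_closedBall_zero_iff]; exact hz.le
  · rw [dist_zero_right]; exact hz

section CutoffMap

variable {V : Type*} [NormedAddCommGroup V] [NormedSpace ℝ V]

/-- The affine map `z ↦ z - S z + θ • v`, interpolated with the identity by the cutoff
function `χ`. -/
def cutoffMap (χ : V → ℝ) (S : V →L[ℝ] V) (v : V) (θ : ℝ) (z : V) : V :=
  z + χ z • (θ • v - S z)

lemma contDiff_cutoffMap {χ : V → ℝ} (hχ : ContDiff ℝ ∞ χ) (S : V →L[ℝ] V) (v : V) :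
    ContDiff ℝ ∞ fun q : ℝ × V => cutoffMap χ S v q.1 q.2 := by
  unfold cutoffMap
  fun_prop

lemma norm_cutoffMap_sub_le {χ : V → ℝ} {R : ℝ} (h01 : ∀ z, 0 ≤ χ z ∧ χ z ≤ 1)
    (hR : ∀ z, R ≤ ‖z‖ → χ z = 0) (S : V →L[ℝ] V) (v : V) {θ : ℝ} (hθ : |θ| ≤ 1) (z : V) :
    ‖cutoffMap χ S v θ z - z‖ ≤ ‖S‖ * |R| + ‖v‖ := by
  rw [cutoffMap, add_sub_cancel_left]
  rcases le_or_gt R ‖z‖ with h | h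
  · rw [hR z h, zero_smul, norm_zero]; positivity
  · have h1 : ‖θ • v - S z‖ ≤ ‖S‖ * |R| + ‖v‖ := by
      refine (norm_sub_le _ _).trans ?_
      have h2 : ‖θ • v‖ ≤ ‖v‖ := by
        rw [norm_smul, Real.norm_eq_abs]
        exact mul_le_of_le_one_left (norm_nonneg _) hθ
      have h3 : ‖S z‖ ≤ ‖S‖ * |R| :=
        (S.le_opNorm z).trans (by gcongr; exact h.le.trans (le_abs_self R))
      linarith
    rw [norm_smul, Real.norm_of_nonneg (h01 z).1]
    exact (mul_le_of_le_one_left (norm_nonneg _) (h01 z).2).trans h1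

lemma norm_fderiv_cutoff_smul_le {χ : V → ℝ} {R B : ℝ} (hχ : ContDiff ℝ ∞ χ)
    (h01 : ∀ z, 0 ≤ χ z ∧ χ z ≤ 1) (hB : 0 ≤ B) (hχB : ∀ z, ‖fderiv ℝ χ z‖ ≤ B)
    (hR : ∀ z, R ≤ ‖z‖ → χ z = 0) (S : V →L[ℝ] V) (v : V) {θ : ℝ} (hθ : |θ| ≤ 1) (z : V) :
    ‖fderiv ℝ (fun z => χ z • (θ • v - S z)) z‖ ≤ B * (‖S‖ * |R| + ‖v‖) + ‖S‖ := by
  rcases lt_or_ge R ‖z‖ with h | h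
  · have : (fun z => χ z • (θ • v - S z)) =ᶠ[𝓝 z] fun _ => 0 := by
      filter_upwards [continuous_norm.continuousAt.eventually (lt_mem_nhds h)] with w hw
      rw [hR w hw.le, zero_smul]
    rw [this.fderiv_eq, fderiv_fun_const]
    simp only [Pi.zero_apply, norm_zero]
    positivity
  · have h1 : ‖θ • v - S z‖ ≤ ‖S‖ * |R| + ‖v‖ := by
      refine (norm_sub_le _ _).trans ?_
      have h2 : ‖θ • v‖ ≤ ‖v‖ := by
        rw [norm_smul, Real.norm_eq_abs]
        exact mul_le_of_le_one_left (norm_nonneg _) hθ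
      have h3 : ‖S z‖ ≤ ‖S‖ * |R| :=
        (S.le_opNorm z).trans (by gcongr; exact h.trans (le_abs_self R))
      linarith
    have hd : HasFDerivAt (fun z => θ • v - S z) (-S) z := by
      simpa using S.hasFDerivAt.const_sub (θ • v)
    have hχd := ((hχ.differentiable (by simp)) z).hasFDerivAt
    rw [(hχd.fun_smul hd).fderiv]
    refine (norm_add_le _ _).trans ?_
    rw [add_comm]
    gcongr
    · rw [ContinuousLinearMap.norm_smulRight_apply]
      exact mul_le_mul (hχB z) h1 (norm_nonneg _) hB
    · rw [norm_smul, norm_neg, Real.norm_of_nonneg (h01 z).1]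
      exact mul_le_of_le_one_left (norm_nonneg _) (h01 z).2

lemma fderiv_cutoffMap_sub_id {χ : V → ℝ} (hχ : ContDiff ℝ ∞ χ) (S : V →L[ℝ] V) (v : V)
    (θ : ℝ) (z : V) : fderiv ℝ (cutoffMap χ S v θ) z - .id ℝ V =
      fderiv ℝ (fun z => χ z • (θ • v - S z)) z := by
  have hp : ContDiff ℝ ∞ fun z => χ z • (θ • v - S z) := by fun_prop
  rw [sub_eq_iff_eq_add']
  exact ((hasFDerivAt_id (𝕜 := ℝ) z).fun_add
    (hp.differentiable (by simp) z).hasFDerivAt).fderiv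

lemma exists_smooth_inverse_cutoffMap [CompleteSpace V] {χ : V → ℝ} {R B : ℝ}
    (hχ : ContDiff ℝ ∞ χ)
    (h01 : ∀ z, 0 ≤ χ z ∧ χ z ≤ 1) (hB : 0 ≤ B) (hχB : ∀ z, ‖fderiv ℝ χ z‖ ≤ B)
    (hR : ∀ z, R ≤ ‖z‖ → χ z = 0) {S : V →L[ℝ] V} {v : V}
    (hSv : B * (‖S‖ * |R| + ‖v‖) + ‖S‖ ≤ 1 / 2) {θ : ℝ} (hθ : |θ| ≤ 1) :
    ∃ G : V → V, ContDiff ℝ ∞ G ∧ Function.LeftInverse G (cutoffMap χ S v θ) ∧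
      Function.RightInverse G (cutoffMap χ S v θ) :=
  exists_smooth_inverse_id_add (by fun_prop)
    fun z => (norm_fderiv_cutoff_smul_le hχ h01 hB hχB hR S v hθ z).trans hSv

end CutoffMap

/-! ### Transplanting maps by a chart -/

section Transplant

variable {M : Type*} [TopologicalSpace M] {V : Type*} [TopologicalSpace V]

open Classical in
/-- The self-map of `M` that is `F` in the chart `Φ` and the identity outside its source. It is
meant for maps `F` that preserve the target of `Φ` and are the identity outside a compact subset of
it; otherwise the value of `Φ.symm` outside its domain may enter. -/
noncomputable def transplant (Φ : OpenPartialHomeomorph M V) (F : V → V) (x : M) : M :=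
  if x ∈ Φ.source then Φ.symm (F (Φ x)) else x

lemma transplant_of_mem {Φ : OpenPartialHomeomorph M V} (F : V → V) {x : M}
    (hx : x ∈ Φ.source) : transplant Φ F x = Φ.symm (F (Φ x)) := if_pos hx

lemma transplant_symm {Φ : OpenPartialHomeomorph M V} (F : V → V) {z : V}
    (hz : z ∈ Φ.target) : transplant Φ F (Φ.symm z) = Φ.symm (F z) := by
  rw [transplant_of_mem F (Φ.map_target hz), Φ.right_inv hz]

lemma transplant_of_notMem {Φ : OpenPartialHomeomorph M V} {F : V → V} {K : Set V}
    (hF : ∀ z ∉ K, F z = z) {x : M} (hx : x ∉ Φ.symm '' K) : transplant Φ F x = x := by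
  by_cases h : x ∈ Φ.source
  · rw [transplant_of_mem F h, hF, Φ.left_inv h]
    exact fun hK => hx ⟨_, hK, Φ.left_inv h⟩
  · exact if_neg h

lemma mapsTo_of_eq_id {V : Type*} {F : V → V} {K : Set V} (hF : ∀ z ∉ K, F z = z)
    (hinj : Function.Injective F) : MapsTo F K K := fun z hz => by
  by_contra h
  rw [hinj (hF _ h)] at h
  exact h hz

lemma transplant_leftInverse {Φ : OpenPartialHomeomorph M V} {F G : V → V}
    (hF : MapsTo F Φ.target Φ.target) (hGF : Function.LeftInverse G F) :
    Function.LeftInverse (transplant Φ G) (transplant Φ F) := fun x => by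
  by_cases h : x ∈ Φ.source
  · rw [transplant_of_mem F h, transplant_symm G (hF (Φ.map_source h)), hGF, Φ.left_inv h]
  · have : transplant Φ F x = x := if_neg h
    rw [this]
    exact if_neg h

lemma mapsTo_target_of_eq_id {Φ : OpenPartialHomeomorph M V} {K : Set V}
    (hKt : K ⊆ Φ.target) {F : V → V} (hFK : ∀ z ∉ K, F z = z) (hinj : Function.Injective F) :
    MapsTo F Φ.target Φ.target := fun z hz => by
  by_cases h : z ∈ K
  · exact hKt (mapsTo_of_eq_id hFK hinj h)
  · rwa [hFK z h]

lemma isRegion_symm_image_closure [T2Space M] {Φ : OpenPartialHomeomorph M V} {U : Set V}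
    (hUo : IsOpen U) (hUc : IsConnected U) (hK : IsCompact (closure U))
    (hUt : closure U ⊆ Φ.target) : IsRegion (Φ.symm '' closure U) := by
  refine ⟨Φ.symm '' U, Φ.symm.isOpen_image_of_subset_source hUo (subset_closure.trans hUt),
    hUc.image _ (Φ.continuousOn_symm.mono (subset_closure.trans hUt)), ?_⟩
  refine Subset.antisymm ?_ ?_
  · exact (Φ.continuousOn_symm.mono hUt).image_closure
  · exact closure_minimal (image_mono subset_closure)
      (hK.image_of_continuousOn (Φ.continuousOn_symm.mono hUt)).isClosed

end Transplant

section SmoothChart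

variable {E : Type*} [NormedAddCommGroup E] [NormedSpace ℝ E]
  {H : Type*} [TopologicalSpace H] {I : ModelWithCorners ℝ E H}
  {M : Type*} [TopologicalSpace M] [ChartedSpace H M]
  {V : Type*} [NormedAddCommGroup V] [NormedSpace ℝ V]

/-- A smooth local diffeomorphism from an open subset of `M` to an open subset of a vector space
`V`. As the target is open in `V`, the source lies in the interior of `M`. -/
structure IsSmoothChart (I : ModelWithCorners ℝ E H) (Φ : OpenPartialHomeomorph M V) : Prop where
  contMDiffOn : ContMDiffOn I 𝓘(ℝ, V) ∞ Φ Φ.source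
  contMDiffOn_symm : ContMDiffOn 𝓘(ℝ, V) I ∞ Φ.symm Φ.target

lemma contMDiff_transplant [T2Space M] {E' : Type*} [NormedAddCommGroup E'] [NormedSpace ℝ E']
    {H' : Type*} [TopologicalSpace H'] {J : ModelWithCorners ℝ E' H'}
    {N : Type*} [TopologicalSpace N] [ChartedSpace H' N]
    {Φ : OpenPartialHomeomorph M V} (hΦ : IsSmoothChart I Φ) {K : Set V} (hK : IsCompact K)
    (hKt : K ⊆ Φ.target) {F : N → V → V}
    (hF : ContMDiff (J.prod 𝓘(ℝ, V)) 𝓘(ℝ, V) ∞ fun q : N × V => F q.1 q.2)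
    (hFK : ∀ s, ∀ z ∉ K, F s z = z) (hFt : ∀ s, MapsTo (F s) Φ.target Φ.target) :
    ContMDiff (J.prod I) I ∞ fun q : N × M => transplant Φ (F q.1) q.2 := by
  rintro ⟨s, x⟩
  by_cases hx : x ∈ Φ.source
  · have hopen : IsOpen {q : N × M | q.2 ∈ Φ.source} := Φ.open_source.preimage continuous_snd
    have h1 : ContMDiffAt (J.prod I) (J.prod 𝓘(ℝ, V)) ∞ (fun q : N × M => (q.1, Φ q.2)) (s, x) :=
      contMDiffAt_fst.prodMk
        (((hΦ.contMDiffOn x hx).contMDiffAt (Φ.open_source.mem_nhds hx)).comp (s, x)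
          contMDiffAt_snd)
    have h2 : ContMDiffAt 𝓘(ℝ, V) I ∞ Φ.symm (F s (Φ x)) :=
      (hΦ.contMDiffOn_symm _ (hFt s (Φ.map_source hx))).contMDiffAt
        (Φ.open_target.mem_nhds (hFt s (Φ.map_source hx)))
    have h3 : ContMDiffAt (J.prod I) I ∞ (fun q : N × M => Φ.symm (F q.1 (Φ q.2))) (s, x) :=
      ContMDiffAt.comp (s, x) (g := Φ.symm) (f := fun q : N × M => F q.1 (Φ q.2)) h2
        ((hF (s, Φ x)).comp (s, x) h1)
    refine h3.congr_of_eventuallyEq ?_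
    filter_upwards [hopen.mem_nhds hx] with q hq
    exact transplant_of_mem _ hq
  · have hcl : IsClosed (Φ.symm '' K) :=
      (hK.image_of_continuousOn (Φ.continuousOn_symm.mono hKt)).isClosed
    have hx' : x ∉ Φ.symm '' K := by
      rintro ⟨z, hz, rfl⟩
      exact hx (Φ.map_target (hKt hz))
    refine (contMDiffAt_snd (n := ∞)).congr_of_eventuallyEq ?_
    filter_upwards [(hcl.isOpen_compl.preimage continuous_snd).mem_nhds
      (show (s, x) ∈ Prod.snd ⁻¹' (Φ.symm '' K)ᶜ from hx')] with q hq
    exact transplant_of_notMem (hFK q.1) hq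

lemma contMDiff_transplant_const [T2Space M]
    {Φ : OpenPartialHomeomorph M V} (hΦ : IsSmoothChart I Φ) {K : Set V} (hK : IsCompact K)
    (hKt : K ⊆ Φ.target) {F : V → V} (hF : ContDiff ℝ ∞ F)
    (hFK : ∀ z ∉ K, F z = z) (hFt : MapsTo F Φ.target Φ.target) :
    ContMDiff I I ∞ (transplant Φ F) := by
  have h := contMDiff_transplant (J := 𝓘(ℝ, ℝ)) (N := ℝ) hΦ hK hKt (F := fun _ => F)
    (hF.contMDiff.comp contMDiff_snd) (fun _ => hFK) (fun _ => hFt)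
  exact h.comp (contMDiff_const (c := (0 : ℝ)) |>.prodMk contMDiff_id)

/-- The diffeomorphism of `M` obtained by transplanting a diffeomorphism `F` of `V` with inverse
`G` that is the identity outside a compact subset of the target of the chart. -/
noncomputable def transplantDiffeomorph [T2Space M]
    {Φ : OpenPartialHomeomorph M V} (hΦ : IsSmoothChart I Φ) {K : Set V} (hK : IsCompact K)
    (hKt : K ⊆ Φ.target) {F G : V → V} (hF : ContDiff ℝ ∞ F) (hG : ContDiff ℝ ∞ G)
    (hFK : ∀ z ∉ K, F z = z) (hGF : Function.LeftInverse G F) (hFG : Function.RightInverse G F) :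
    M ≃ₘ^∞⟮I, I⟯ M :=
  have hGK : ∀ z ∉ K, G z = z := fun z hz => by
    have := hGF z
    rwa [hFK z hz] at this
  have hFt := mapsTo_target_of_eq_id hKt hFK hGF.injective
  have hGt := mapsTo_target_of_eq_id hKt hGK hFG.injective
  { toFun := transplant Φ F
    invFun := transplant Φ G
    left_inv := transplant_leftInverse hFt hGF
    right_inv := transplant_leftInverse hGt hFG
    contMDiff_toFun := contMDiff_transplant_const hΦ hK hKt hF hFK hFt
    contMDiff_invFun := contMDiff_transplant_const hΦ hK hKt hG hGK hGt }

end SmoothChart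

/-! ### The Riemannian metric in a chart -/

section ChartFrame

variable {E : Type*} [NormedAddCommGroup E] [NormedSpace ℝ E]
  {H : Type*} [TopologicalSpace H] {I : ModelWithCorners ℝ E H}
  {M : Type*} [TopologicalSpace M] [ChartedSpace H M]
  {V : Type*} [NormedAddCommGroup V] [NormedSpace ℝ V]

lemma IsSmoothChart.mdifferentiable {Φ : OpenPartialHomeomorph M V} (hΦ : IsSmoothChart I Φ) :
    Φ.MDifferentiable I 𝓘(ℝ, V) :=
  ⟨hΦ.contMDiffOn.mdifferentiableOn (by simp), hΦ.contMDiffOn_symm.mdifferentiableOn (by simp)⟩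

variable (I) in
/-- The differential at `z` of the inverse of the chart `Φ`, with domain `V` in place of the
tangent space of `V` at `z`. -/
noncomputable def chartFrame (Φ : OpenPartialHomeomorph M V) (z : V) :
    V →L[ℝ] TangentSpace I (Φ.symm z) :=
  mfderiv 𝓘(ℝ, V) I Φ.symm z

lemma bijective_chartFrame {Φ : OpenPartialHomeomorph M V} (hΦ : IsSmoothChart I Φ) {z : V}
    (hz : z ∈ Φ.target) : Function.Bijective (chartFrame I Φ z) :=
  hΦ.mdifferentiable.symm.mfderiv_bijective hz

lemma IsSmoothChart.transHomeomorph {V' : Type*} [NormedAddCommGroup V'] [NormedSpace ℝ V']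
    {Φ : OpenPartialHomeomorph M V} (hΦ : IsSmoothChart I Φ) (h : V ≃ₜ V')
    (h1 : ContDiff ℝ ∞ h) (h2 : ContDiff ℝ ∞ h.symm) :
    IsSmoothChart I (Φ.transHomeomorph h) :=
  ⟨h1.contMDiff.comp_contMDiffOn hΦ.contMDiffOn,
    hΦ.contMDiffOn_symm.comp h2.contMDiff.contMDiffOn fun _ hz => hz⟩

/-- A manifold, even with corners, has interior points: the range of the model with corners is
contained in the closure of its interior, so that the target of a chart contains an open set. -/
lemma exists_isSmoothChart (I : ModelWithCorners ℝ E H) [IsManifold I ∞ M] [Nonempty M] :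
    ∃ Φ : OpenPartialHomeomorph M E, IsSmoothChart I Φ ∧ Φ.target.Nonempty := by
  obtain ⟨x⟩ := ‹Nonempty M›
  set φ := extChartAt I x with hφ
  let Φ : OpenPartialHomeomorph M E :=
    { toFun := φ
      invFun := φ.symm
      source := φ.source ∩ φ ⁻¹' interior φ.target
      target := interior φ.target
      map_source' := fun y hy => hy.2
      map_target' := fun z hz => ⟨φ.map_target (interior_subset hz), by
        rw [mem_preimage, φ.right_inv (interior_subset hz)]; exact hz⟩
      left_inv' := fun y hy => φ.left_inv hy.1
      right_inv' := fun z hz => φ.right_inv (interior_subset hz)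
      open_source := (continuousOn_extChartAt x).isOpen_inter_preimage
        (isOpen_extChartAt_source x) isOpen_interior
      open_target := isOpen_interior
      continuousOn_toFun := (continuousOn_extChartAt x).mono inter_subset_left
      continuousOn_invFun := (continuousOn_extChartAt_symm x).mono interior_subset }
  refine ⟨Φ, ⟨?_, ?_⟩, ?_⟩
  · refine (contMDiffOn_extChartAt (I := I) (x := x) (n := ∞)).mono fun y hy => ?_
    have := hy.1
    rwa [hφ, extChartAt_source] at this
  · exact (contMDiffOn_extChartAt_symm (I := I) x (n := ∞)).mono interior_subset
  · obtain ⟨O, hO, hxO, hOt⟩ := mem_nhdsWithin.1 (extChartAt_target_mem_nhdsWithin (I := I) x)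
    have hxr : φ x ∈ closure (interior (range I)) :=
      I.range_subset_closure_interior (mem_range_self _)
    obtain ⟨z, hzO, hzr⟩ := mem_closure_iff.1 hxr O hO hxO
    exact ⟨z, (interior_maximal (fun w hw => hOt ⟨hw.1, interior_subset hw.2⟩)
      (hO.inter isOpen_interior)) ⟨hzO, hzr⟩⟩

lemma euclideanDifferential_chartFrame {Φ : OpenPartialHomeomorph M V} (hΦ : IsSmoothChart I Φ)
    {N : ℕ} {g : M → EuclideanSpace ℝ (Fin N)}
    (hg : MDifferentiable I 𝓘(ℝ, EuclideanSpace ℝ (Fin N)) g) {z : V} (hz : z ∈ Φ.target)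
    (u : V) :
    euclideanDifferential I g (Φ.symm z) (chartFrame I Φ z u) =
      fderiv ℝ (fun z => g (Φ.symm z)) z u := by
  have hz' := (hΦ.mdifferentiable.mdifferentiableAt_symm hz).hasMFDerivAt
  have h1 := (HasMFDerivAt.comp z (hg (Φ.symm z)).hasMFDerivAt hz').mfderiv
  rw [mfderiv_eq_fderiv] at h1
  exact (congrArg (fun L : V →L[ℝ] EuclideanSpace ℝ (Fin N) => L u) h1).symm

variable [RiemannianBundle (fun x : M => TangentSpace I x)]

variable (I) in
/-- The bilinear form on `V` which the Riemannian metric of `M` induces at the point `z` of the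
chart `Φ`. -/
noncomputable def chartMetric (Φ : OpenPartialHomeomorph M V) (z u w : V) : ℝ :=
  inner ℝ (chartFrame I Φ z u) (chartFrame I Φ z w)

lemma chartMetric_self (Φ : OpenPartialHomeomorph M V) (z u : V) :
    chartMetric I Φ z u u = ‖chartFrame I Φ z u‖ ^ 2 :=
  real_inner_self_eq_norm_sq _

lemma chartMetric_transHomeomorph {V' : Type*} [NormedAddCommGroup V'] [NormedSpace ℝ V']
    {Φ : OpenPartialHomeomorph M V} (hΦ : IsSmoothChart I Φ) (A : V ≃L[ℝ] V') (z₀ : V) {w : V'}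
    (hw : A.symm w + z₀ ∈ Φ.target) (u u' : V') :
    chartMetric I (Φ.transHomeomorph ((Homeomorph.subRight z₀).trans A.toHomeomorph)) w u u' =
      chartMetric I Φ (A.symm w + z₀) (A.symm u) (A.symm u') := by
  have hd : HasMFDerivAt 𝓘(ℝ, V') 𝓘(ℝ, V) (fun w => A.symm w + z₀) w
      (A.symm : V' →L[ℝ] V) :=
    ((A.symm.hasFDerivAt (x := w)).add_const z₀).hasMFDerivAt
  have hΦd := (hΦ.mdifferentiable.mdifferentiableAt_symm hw).hasMFDerivAt
  have key : ∀ v : V', chartFrame I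
      (Φ.transHomeomorph ((Homeomorph.subRight z₀).trans A.toHomeomorph)) w v =
      chartFrame I Φ (A.symm w + z₀) (A.symm v) := fun v => by
    have := (HasMFDerivAt.comp w hΦd hd).mfderiv
    exact congrArg (fun L => L v) this
  unfold chartMetric
  rw [key, key]
  rfl

/-- Coordinates centred at an interior point in which the metric at that point is the Euclidean
one. -/
lemma exists_chart_isometric_at_zero [FiniteDimensional ℝ E] [IsManifold I ∞ M] [Nonempty M] :
    ∃ (n : ℕ) (Φ : OpenPartialHomeomorph M (EuclideanSpace ℝ (Fin n))), IsSmoothChart I Φ ∧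
      0 ∈ Φ.target ∧ ∀ u w, chartMetric I Φ 0 u w = inner ℝ u w := by
  obtain ⟨Φ₀, hΦ₀, z₀, hz₀⟩ := exists_isSmoothChart (M := M) I
  have hfd : FiniteDimensional ℝ (TangentSpace I (Φ₀.symm z₀)) :=
    inferInstanceAs (FiniteDimensional ℝ E)
  let b := stdOrthonormalBasis ℝ (TangentSpace I (Φ₀.symm z₀))
  let B : E ≃ₗ[ℝ] TangentSpace I (Φ₀.symm z₀) :=
    LinearEquiv.ofBijective (chartFrame I Φ₀ z₀ : E →ₗ[ℝ] TangentSpace I (Φ₀.symm z₀))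
      (bijective_chartFrame hΦ₀ hz₀)
  let A := (B.trans b.repr.toLinearEquiv).toContinuousLinearEquiv
  have hA : ∀ u, chartFrame I Φ₀ z₀ (A.symm u) = b.repr.symm u := fun u =>
    B.apply_symm_apply (b.repr.symm u)
  have h0 : A.symm 0 + z₀ = z₀ := by rw [map_zero, zero_add]
  refine ⟨_, Φ₀.transHomeomorph ((Homeomorph.subRight z₀).trans A.toHomeomorph),
    hΦ₀.transHomeomorph _ ?_ ?_, ?_, fun u w => ?_⟩
  · exact A.contDiff.comp (contDiff_id.sub contDiff_const)
  · exact A.symm.contDiff.add contDiff_const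
  · change A.symm 0 + z₀ ∈ Φ₀.target
    rwa [h0]
  · rw [chartMetric_transHomeomorph hΦ₀ A z₀ (by rwa [h0]), h0, chartMetric, hA, hA]
    exact b.repr.symm.inner_map_map u w

lemma contDiffOn_chartMetric [IsManifold I ∞ M]
    [IsContMDiffRiemannianBundle I ∞ E (fun x : M => TangentSpace I x)]
    {Φ : OpenPartialHomeomorph M V} (hΦ : IsSmoothChart I Φ) (u w : V) :
    ContDiffOn ℝ ∞ (fun z => chartMetric I Φ z u w) Φ.target := by
  have hsec : ∀ u : V, ContMDiffOn 𝓘(ℝ, V) I.tangent ∞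
      (fun z => (⟨Φ.symm z, chartFrame I Φ z u⟩ : TangentBundle I M)) Φ.target := fun u => by
    have h1 : ContMDiff 𝓘(ℝ, V) 𝓘(ℝ, V).tangent ∞
        (fun z => (⟨z, u⟩ : TangentBundle 𝓘(ℝ, V) V)) :=
      contMDiff_vectorSpace_iff_contDiff.2 contDiff_const
    have h2 := hΦ.contMDiffOn_symm.contMDiffOn_tangentMapWithin (m := ∞) (by simp)
      Φ.open_target.uniqueMDiffOn
    refine (h2.comp h1.contMDiffOn (fun z hz => hz)).congr fun z hz => ?_
    simp only [Function.comp, tangentMapWithin, mfderivWithin_of_isOpen Φ.open_target hz]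
    rfl
  have := ContMDiffOn.inner_bundle (E := fun x : M => TangentSpace I x) (b := Φ.symm)
    (v := fun z => chartFrame I Φ z u) (w := fun z => chartFrame I Φ z w) (hsec u) (hsec w)
  exact contMDiffOn_iff_contDiffOn.1 this

end ChartFrame

/-! ### Contraction and `C¹` estimates -/

section Contraction

variable {V T₁ T₂ : Type*} [NormedAddCommGroup V] [InnerProductSpace ℝ V]
  [NormedAddCommGroup T₁] [InnerProductSpace ℝ T₁] [NormedAddCommGroup T₂] [InnerProductSpace ℝ T₂]

/-- Comparison of norms along the map `u ↦ u - S u`: `A₁` and `A₂` stand for the inverse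
differentials of a chart at a point and at its image. The gain
`≈ τ ‖u‖²` from the contraction `1 - S` exceeds the error `α` of the metric at the
first point with respect to the Euclidean one, and the change `β` of the metric between the two
points. -/
lemma norm_map_sub_sq_le (A₁ : V →L[ℝ] T₁) (A₂ : V →L[ℝ] T₂) (S : V →L[ℝ] V)
    {k τ α β : ℝ} (hk : 1 ≤ k) (hτ : 0 < τ) (hα : 0 ≤ α)
    (hSle : ∀ u, ‖S u‖ ≤ k * τ * ‖u‖)
    (hSge : ∀ u, τ / 2 * ‖u‖ ^ 2 ≤ inner ℝ u (S u)) (hDS : ∀ u, ‖u - S u‖ ≤ ‖u‖)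
    (h₁ : ∀ u w, |inner ℝ (A₁ u) (A₁ w) - inner ℝ u w| ≤ α * ‖u‖ * ‖w‖)
    (h₂ : ∀ u w, |inner ℝ (A₂ u) (A₂ w) - inner ℝ (A₁ u) (A₁ w)| ≤ β * ‖u‖ * ‖w‖)
    (hαk : α * k ≤ 1 / 16) (hτk : k ^ 2 * τ ≤ 1 / 16) (hβτ : β ≤ τ / 4) (u : V) :
    ‖A₂ (u - S u)‖ ^ 2 ≤ (1 - τ / 8) * ‖A₁ u‖ ^ 2 := by
  have hα1 : α ≤ 1 / 16 := by nlinarith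
  have hu := norm_nonneg u
  have hSu := norm_nonneg (S u)
  have e1 : ‖A₁ u‖ ^ 2 ≤ 2 * ‖u‖ ^ 2 := by
    have := (abs_le.1 (h₁ u u)).2
    rw [real_inner_self_eq_norm_sq, real_inner_self_eq_norm_sq] at this
    nlinarith [sq_nonneg ‖u‖]
  have e2 : ‖A₁ (S u)‖ ^ 2 ≤ τ / 8 * ‖u‖ ^ 2 := by
    have h := (abs_le.1 (h₁ (S u) (S u))).2
    rw [real_inner_self_eq_norm_sq, real_inner_self_eq_norm_sq] at h
    have h3 : ‖S u‖ ^ 2 ≤ (k * τ * ‖u‖) ^ 2 := by gcongr; exact hSle u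
    have h4 : (k * τ * ‖u‖) ^ 2 ≤ τ / 16 * ‖u‖ ^ 2 := by
      have : (k * τ * ‖u‖) ^ 2 = (k ^ 2 * τ) * (τ * ‖u‖ ^ 2) := by ring
      rw [this]
      have : 0 ≤ τ * ‖u‖ ^ 2 := by positivity
      nlinarith
    have h5 : α * ‖S u‖ * ‖S u‖ ≤ ‖S u‖ ^ 2 := by nlinarith [sq_nonneg ‖S u‖]
    linarith
  have e3 : 3 / 8 * τ * ‖u‖ ^ 2 ≤ inner ℝ (A₁ u) (A₁ (S u)) := by
    have h := (abs_le.1 (h₁ u (S u))).1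
    have h3 : α * ‖u‖ * ‖S u‖ ≤ α * ‖u‖ * (k * τ * ‖u‖) := by gcongr; exact hSle u
    have h4 : α * ‖u‖ * (k * τ * ‖u‖) = α * k * (τ * ‖u‖ ^ 2) := by ring
    have h5 : α * k * (τ * ‖u‖ ^ 2) ≤ 1 / 16 * (τ * ‖u‖ ^ 2) := by gcongr
    have := hSge u
    nlinarith [mul_nonneg hτ.le (sq_nonneg ‖u‖)]
  have e4 : ‖A₁ (u - S u)‖ ^ 2 ≤ ‖A₁ u‖ ^ 2 - 5 / 8 * τ * ‖u‖ ^ 2 := by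
    rw [map_sub, norm_sub_sq_real]
    linarith
  have e5 : ‖A₂ (u - S u)‖ ^ 2 ≤ ‖A₁ (u - S u)‖ ^ 2 + τ / 8 * ‖u‖ ^ 2 + τ / 8 * ‖u‖ ^ 2 := by
    have h := (abs_le.1 (h₂ (u - S u) (u - S u))).2
    rw [real_inner_self_eq_norm_sq, real_inner_self_eq_norm_sq] at h
    have h3 : β * ‖u - S u‖ * ‖u - S u‖ ≤ τ / 4 * ‖u‖ * ‖u‖ := by
      gcongr <;> exact hDS u
    linarith [h3, (by ring : τ / 4 * ‖u‖ * ‖u‖ = τ / 8 * ‖u‖ ^ 2 + τ / 8 * ‖u‖ ^ 2)]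
  nlinarith [mul_le_mul_of_nonneg_left e1 hτ.le, mul_nonneg hτ.le (sq_nonneg ‖u‖)]

end Contraction

/-- Composition on the right with a map that is `C¹` close to the identity changes a smooth map
little in `C¹` norm over a compact set. -/
lemma exists_c1_modulus {V W : Type*} [NormedAddCommGroup V] [NormedSpace ℝ V]
    [NormedAddCommGroup W] [NormedSpace ℝ W] {t K : Set V} (ht : IsOpen t) (hK : IsCompact K)
    (hKt : K ⊆ t) {g : V → W} (hg : ContDiffOn ℝ ∞ g t) {ε : ℝ} (hε : 0 < ε) :
    ∃ η > 0, ∀ F : V → V, Differentiable ℝ F → MapsTo F K K → (∀ z, ‖F z - z‖ ≤ η) →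
      (∀ z, ‖fderiv ℝ F z - .id ℝ V‖ ≤ η) → ∀ z ∈ K, ‖g (F z) - g z‖ ≤ ε ∧
        ‖fderiv ℝ (fun z => g (F z)) z - fderiv ℝ g z‖ ≤ ε := by
  have hgc : ContinuousOn g K := hg.continuousOn.mono hKt
  have hgd : ContinuousOn (fderiv ℝ g) K :=
    (hg.continuousOn_fderiv_of_isOpen ht (by simp)).mono hKt
  obtain ⟨η₁, hη₁, h₁⟩ := Metric.uniformContinuousOn_iff_le.1
    (hK.uniformContinuousOn_of_continuous hgc) ε hε
  obtain ⟨η₂, hη₂, h₂⟩ := Metric.uniformContinuousOn_iff_le.1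
    (hK.uniformContinuousOn_of_continuous hgd) (ε / 2) (by positivity)
  obtain ⟨C, hC⟩ := hK.exists_bound_of_continuousOn hgd
  set C' := max C 1 with hC'
  have hC'0 : 0 < C' := lt_max_of_lt_right one_pos
  refine ⟨min (min η₁ η₂) (ε / (2 * C')), by positivity, fun F hF hFK hFη hFη' z hz => ⟨?_, ?_⟩⟩
  · rw [← dist_eq_norm]
    refine h₁ _ (hFK hz) _ hz ?_
    rw [dist_eq_norm]
    exact (hFη z).trans ((min_le_left _ _).trans (min_le_left _ _))
  · have hgF : HasFDerivAt g (fderiv ℝ g (F z)) (F z) :=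
      ((hg.differentiableOn (by simp)).differentiableAt
        (ht.mem_nhds (hKt (hFK hz)))).hasFDerivAt
    have hcomp : fderiv ℝ (fun z => g (F z)) z = (fderiv ℝ g (F z)).comp (fderiv ℝ F z) :=
      (hgF.comp z (hF z).hasFDerivAt).fderiv
    have hsplit : fderiv ℝ (fun z => g (F z)) z - fderiv ℝ g z =
        (fderiv ℝ g (F z)).comp (fderiv ℝ F z - .id ℝ V) +
          (fderiv ℝ g (F z) - fderiv ℝ g z) := by
      rw [hcomp, ContinuousLinearMap.comp_sub, ContinuousLinearMap.comp_id]
      abel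
    rw [hsplit]
    have e1 : ‖(fderiv ℝ g (F z)).comp (fderiv ℝ F z - .id ℝ V)‖ ≤ ε / 2 := by
      calc _ ≤ ‖fderiv ℝ g (F z)‖ * ‖fderiv ℝ F z - .id ℝ V‖ :=
            ContinuousLinearMap.opNorm_comp_le _ _
        _ ≤ C' * (ε / (2 * C')) := by
            gcongr
            · exact (hC _ (hFK hz)).trans (le_max_left _ _)
            · exact (hFη' z).trans (min_le_right _ _)
        _ = ε / 2 := by field_simp
    have e2 : ‖fderiv ℝ g (F z) - fderiv ℝ g z‖ ≤ ε / 2 := by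
      rw [← dist_eq_norm]
      refine h₂ _ (hFK hz) _ hz ?_
      rw [dist_eq_norm]
      exact (hFη z).trans ((min_le_left _ _).trans (min_le_right _ _))
    exact (norm_add_le _ _).trans (by linarith)

section Riemannian

variable {E : Type*} [NormedAddCommGroup E] [NormedSpace ℝ E]
  {H : Type*} [TopologicalSpace H] {I : ModelWithCorners ℝ E H}
  {M : Type*} [TopologicalSpace M] [ChartedSpace H M]
  [RiemannianBundle (fun x : M => TangentSpace I x)]

lemma chartMetric_eq_sum {n : ℕ} (Φ : OpenPartialHomeomorph M (EuclideanSpace ℝ (Fin n)))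
    (z u w : EuclideanSpace ℝ (Fin n)) :
    chartMetric I Φ z u w = ∑ i, ∑ j, u i * w j *
      chartMetric I Φ z (EuclideanSpace.single i 1) (EuclideanSpace.single j 1) := by
  have hsum : ∀ u : EuclideanSpace ℝ (Fin n), u = ∑ i, u i • EuclideanSpace.single i (1 : ℝ) :=
    fun u => by
      ext i
      simp [Finset.sum_apply, Pi.single_apply]
  unfold chartMetric
  conv_lhs => rw [hsum u, hsum w, map_sum, map_sum, sum_inner]
  refine Finset.sum_congr rfl fun i _ => ?_
  rw [inner_sum]
  refine Finset.sum_congr rfl fun j _ => ?_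
  rw [map_smul, map_smul, real_inner_smul_left, real_inner_smul_right, mul_assoc]

lemma exists_chartMetric_lipschitz [IsManifold I ∞ M]
    [IsContMDiffRiemannianBundle I ∞ E (fun x : M => TangentSpace I x)] {n : ℕ}
    {Φ : OpenPartialHomeomorph M (EuclideanSpace ℝ (Fin n))} (hΦ : IsSmoothChart I Φ)
    (h0 : 0 ∈ Φ.target) :
    ∃ C R : ℝ, 0 ≤ C ∧ 0 < R ∧ Metric.closedBall 0 R ⊆ Φ.target ∧
      ∀ z ∈ Metric.closedBall 0 R, ∀ z' ∈ Metric.closedBall 0 R, ∀ u w,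
        |chartMetric I Φ z u w - chartMetric I Φ z' u w| ≤ C * ‖z - z'‖ * ‖u‖ * ‖w‖ := by
  obtain ⟨R, hR, hRt⟩ := Metric.nhds_basis_closedBall.mem_iff.1 (Φ.open_target.mem_nhds h0)
  have hlip := fun i j => ((contDiffOn_chartMetric hΦ (EuclideanSpace.single i 1)
    (EuclideanSpace.single j 1)).mono hRt).exists_lipschitzOnWith (by simp)
      (convex_closedBall _ _) (isCompact_closedBall _ _)
  choose κ hκ using hlip
  refine ⟨∑ i, ∑ j, (κ i j : ℝ), R, by positivity, hR, hRt, fun z hz z' hz' u w => ?_⟩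
  rw [chartMetric_eq_sum Φ z, chartMetric_eq_sum Φ z', ← Finset.sum_sub_distrib]
  simp only [← Finset.sum_sub_distrib, Finset.sum_mul]
  refine (Finset.abs_sum_le_sum_abs _ _).trans (Finset.sum_le_sum fun i _ => ?_)
  refine (Finset.abs_sum_le_sum_abs _ _).trans (Finset.sum_le_sum fun j _ => ?_)
  have h1 := (hκ i j).dist_le_mul z hz z' hz'
  rw [Real.dist_eq, dist_eq_norm] at h1
  rw [← mul_sub, abs_mul, abs_mul]
  have hu : |u i| ≤ ‖u‖ := PiLp.norm_apply_le u i
  have hw : |w j| ≤ ‖w‖ := PiLp.norm_apply_le w j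
  calc |u i| * |w j| * _ ≤ ‖u‖ * ‖w‖ * (κ i j * ‖z - z'‖) := by gcongr
    _ = _ := by ring

variable {V : Type*} [NormedAddCommGroup V] [NormedSpace ℝ V]

lemma norm_mfderiv_transplant {Φ : OpenPartialHomeomorph M V} (hΦ : IsSmoothChart I Φ)
    {F : V → V} (hF : Differentiable ℝ F) (hT : MDifferentiable I I (transplant Φ F))
    {z : V} (hz : z ∈ Φ.target) (hFz : F z ∈ Φ.target) (u : V) :
    ‖mfderiv I I (transplant Φ F) (Φ.symm z) (chartFrame I Φ z u)‖ =
      ‖chartFrame I Φ (F z) (fderiv ℝ F z u)‖ := by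
  have hz' := (hΦ.mdifferentiable.mdifferentiableAt_symm hz).hasMFDerivAt
  have hF' := (hΦ.mdifferentiable.mdifferentiableAt_symm hFz).hasMFDerivAt
  have h1 := (HasMFDerivAt.comp z (hT (Φ.symm z)).hasMFDerivAt hz').mfderiv
  have h2 := (HasMFDerivAt.comp z hF' (hF z).hasFDerivAt.hasMFDerivAt).mfderiv
  have heq : transplant Φ F ∘ Φ.symm =ᶠ[𝓝 z] Φ.symm ∘ F := by
    filter_upwards [Φ.open_target.mem_nhds hz] with w hw using transplant_symm F hw
  have h3 := heq.mfderiv_eq (I := 𝓘(ℝ, V)) (I' := I)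
  -- The two derivatives live in tangent spaces at points that are only propositionally equal, so
  -- the norm is viewed as a function of a base point and of a vector of `E`.
  let nrm : M → E → ℝ := fun y v => @norm (TangentSpace I y) _ v
  refine congrArg₂ nrm heq.eq_of_nhds ?_
  have h4 := h1.symm.trans (h3.trans h2)
  exact congrArg (fun L : V →L[ℝ] E => L u) h4

/-- A map of `V` that is `C¹` close to the identity, and equal to it outside a compact subset of the
chart, is close to the identity of `M` in the `C¹` distance defined by a smooth map to `ℝ ^ N`. -/
lemma exists_c1Dist_transplant_lt [T2Space M] {Φ : OpenPartialHomeomorph M V}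
    (hΦ : IsSmoothChart I Φ)
    {K : Set V} (hK : IsCompact K) (hKt : K ⊆ Φ.target)
    (hKn : ∀ z ∈ K, ∀ u, ‖u‖ ≤ 2 * ‖chartFrame I Φ z u‖)
    {N : ℕ} {e : M → EuclideanSpace ℝ (Fin N)}
    (he : ContMDiff I 𝓘(ℝ, EuclideanSpace ℝ (Fin N)) ∞ e) {ε : ℝ} (hε : 0 < ε) :
    ∃ η > 0, ∀ F : V → V, ContDiff ℝ ∞ F → Function.Injective F → (∀ z ∉ K, F z = z) →
      (∀ z, ‖F z - z‖ ≤ η) → (∀ z, ‖fderiv ℝ F z - .id ℝ V‖ ≤ η) →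
      c1Dist I e (transplant Φ F) id < ENNReal.ofReal ε := by
  have hg : ContDiffOn ℝ ∞ (fun z => e (Φ.symm z)) Φ.target :=
    contMDiffOn_iff_contDiffOn.1 (he.comp_contMDiffOn hΦ.contMDiffOn_symm)
  obtain ⟨η, hη, hη'⟩ := exists_c1_modulus Φ.open_target hK hKt hg
    (show 0 < ε / 6 by positivity)
  refine ⟨η, hη, fun F hF hFi hFK h1 h2 => ?_⟩
  have hFKK := mapsTo_of_eq_id hFK hFi
  have hest := hη' F (hF.differentiable (by simp)) hFKK h1 h2
  have hT : ContMDiff I I ∞ (transplant Φ F) :=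
    contMDiff_transplant_const hΦ hK hKt hF hFK (mapsTo_target_of_eq_id hKt hFK hFi)
  have heT : MDifferentiable I 𝓘(ℝ, EuclideanSpace ℝ (Fin N)) (e ∘ transplant Φ F) :=
    (he.comp hT).mdifferentiable (by simp)
  have hcl : IsClosed (Φ.symm '' K) :=
    (hK.image_of_continuousOn (Φ.continuousOn_symm.mono hKt)).isClosed
  have hpos : (0 : ℝ) ≤ ε / 3 := by positivity
  have hsup0 : (⨆ x : M, ENNReal.ofReal ‖e (transplant Φ F x) - e (id x)‖) ≤
      ENNReal.ofReal (ε / 3) := by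
    refine iSup_le fun x => ENNReal.ofReal_le_ofReal ?_
    by_cases hx : x ∈ Φ.symm '' K
    · obtain ⟨z, hz, rfl⟩ := hx
      rw [transplant_symm F (hKt hz)]
      exact (hest z hz).1.trans (by linarith)
    · rw [transplant_of_notMem hFK hx]
      simpa using hpos
  have hsup1 : (⨆ x : M, ENNReal.ofReal ‖euclideanDifferential I (e ∘ transplant Φ F) x -
      euclideanDifferential I (e ∘ id) x‖) ≤ ENNReal.ofReal (ε / 3) := by
    refine iSup_le fun x => ENNReal.ofReal_le_ofReal ?_
    by_cases hx : x ∈ Φ.symm '' K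
    · obtain ⟨z, hz, rfl⟩ := hx
      refine ContinuousLinearMap.opNorm_le_bound _ hpos fun v => ?_
      obtain ⟨u, rfl⟩ := (bijective_chartFrame hΦ (hKt hz)).2 v
      rw [sub_apply, euclideanDifferential_chartFrame hΦ heT (hKt hz),
        Function.comp_id,
        euclideanDifferential_chartFrame hΦ (he.mdifferentiable (by simp)) (hKt hz)]
      have heq : (fun z => (e ∘ transplant Φ F) (Φ.symm z)) =ᶠ[𝓝 z]
          fun z => e (Φ.symm (F z)) := by
        filter_upwards [Φ.open_target.mem_nhds (hKt hz)] with w hw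
        rw [Function.comp_apply, transplant_symm F hw]
      rw [heq.fderiv_eq, ← sub_apply]
      calc _ ≤ ε / 6 * ‖u‖ := ContinuousLinearMap.le_of_opNorm_le _ (hest z hz).2 u
        _ ≤ ε / 6 * (2 * ‖chartFrame I Φ z u‖) := by gcongr; exact hKn z hz u
        _ = ε / 3 * ‖chartFrame I Φ z u‖ := by ring
    · have heq : e ∘ transplant Φ F =ᶠ[𝓝 x] e ∘ id := by
        filter_upwards [hcl.isOpen_compl.mem_nhds hx] with y hy
        rw [Function.comp_apply, transplant_of_notMem hFK hy]
        rfl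
      have h0 : euclideanDifferential I (e ∘ transplant Φ F) x =
          euclideanDifferential I (e ∘ id) x := heq.mfderiv_eq
      refine ContinuousLinearMap.opNorm_le_bound _ hpos fun v => ?_
      rw [h0, sub_self, zero_apply, norm_zero]
      positivity
  calc c1Dist I e (transplant Φ F) id
      ≤ ENNReal.ofReal (ε / 3) + ENNReal.ofReal (ε / 3) := add_le_add hsup0 hsup1
    _ = ENNReal.ofReal (ε / 3 + ε / 3) := (ENNReal.ofReal_add hpos hpos).symm
    _ < ENNReal.ofReal ε := (ENNReal.ofReal_lt_ofReal_iff hε).2 (by linarith)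

end Riemannian

section Riemannian

variable {E : Type*} [NormedAddCommGroup E] [NormedSpace ℝ E]
  {H : Type*} [TopologicalSpace H] {I : ModelWithCorners ℝ E H}
  {M : Type*} [TopologicalSpace M] [ChartedSpace H M]
  [RiemannianBundle (fun x : M => TangentSpace I x)]
  {V : Type*} [NormedAddCommGroup V] [InnerProductSpace ℝ V]

lemma norm_le_two_mul_norm_chartFrame {Φ : OpenPartialHomeomorph M V} {α : ℝ} {z : V}
    (h : ∀ u w, |chartMetric I Φ z u w - inner ℝ u w| ≤ α * ‖u‖ * ‖w‖) (hα : α ≤ 1 / 2) (u : V) :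
    ‖u‖ ≤ 2 * ‖chartFrame I Φ z u‖ := by
  have h1 := (abs_le.1 (h u u)).1
  rw [chartMetric_self, real_inner_self_eq_norm_sq] at h1
  have h2 : α * ‖u‖ * ‖u‖ ≤ 1 / 2 * ‖u‖ * ‖u‖ := by gcongr
  refine abs_le_of_sq_le_sq' ?_ (by positivity) |>.2
  nlinarith [sq_nonneg ‖u‖]

/-- At a point of the chart where `F` has differential `1 - S`, the transplanted map is a strict
contraction for the Riemannian metric. -/
lemma norm_mfderiv_transplant_lt_one {Φ : OpenPartialHomeomorph M V} (hΦ : IsSmoothChart I Φ)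
    {F : V → V} (hF : Differentiable ℝ F) (hT : MDifferentiable I I (transplant Φ F))
    {S : V →L[ℝ] V} {k τ α β : ℝ} (hk : 1 ≤ k) (hτ : 0 < τ) (hα : 0 ≤ α)
    (hSle : ∀ u, ‖S u‖ ≤ k * τ * ‖u‖)
    (hSge : ∀ u, τ / 2 * ‖u‖ ^ 2 ≤ inner ℝ u (S u)) (hDS : ∀ u, ‖u - S u‖ ≤ ‖u‖)
    {z : V} (hz : z ∈ Φ.target) (hFz : F z ∈ Φ.target) (hFS : fderiv ℝ F z = .id ℝ V - S)
    (h₁ : ∀ u w, |chartMetric I Φ z u w - inner ℝ u w| ≤ α * ‖u‖ * ‖w‖)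
    (h₂ : ∀ u w, |chartMetric I Φ (F z) u w - chartMetric I Φ z u w| ≤ β * ‖u‖ * ‖w‖)
    (hαk : α * k ≤ 1 / 16) (hτk : k ^ 2 * τ ≤ 1 / 16) (hβτ : β ≤ τ / 4) :
    ‖mfderiv I I (transplant Φ F) (Φ.symm z)‖ < 1 := by
  have hτ1 : τ ≤ 1 := by nlinarith
  refine lt_of_le_of_lt (b := √(1 - τ / 8))
    (ContinuousLinearMap.opNorm_le_bound _ (Real.sqrt_nonneg _) fun v => ?_)
    ((Real.sqrt_lt' one_pos).2 (by linarith))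
  obtain ⟨u, rfl⟩ := (bijective_chartFrame hΦ hz).2 v
  rw [norm_mfderiv_transplant hΦ hF hT hz hFz, hFS]
  have h := norm_map_sub_sq_le (chartFrame I Φ z) (chartFrame I Φ (F z)) S hk hτ hα hSle hSge hDS
    h₁ h₂ hαk hτk hβτ u
  rw [sub_apply, ContinuousLinearMap.id_apply]
  refine abs_le_of_sq_le_sq' ?_ (by positivity) |>.2
  rwa [mul_pow, Real.sq_sqrt (by linarith)]

/-- A chart `Φ` and a radius `r` such that, on the ball of radius `r`, the metric is `C`-Lipschitz
and differs from the Euclidean one by at most `1 / (16 (n + 1))`. The radius does not depend on the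
scale `τ` of the contraction. -/
lemma exists_chart_with_metric_bounds [FiniteDimensional ℝ E] [IsManifold I ∞ M] [Nonempty M]
    [IsContMDiffRiemannianBundle I ∞ E (fun x : M => TangentSpace I x)] :
    ∃ (n : ℕ) (Φ : OpenPartialHomeomorph M (EuclideanSpace ℝ (Fin n))) (C r : ℝ),
      IsSmoothChart I Φ ∧ 0 ≤ C ∧ 0 < r ∧ C * r * (n + 1) ≤ 1 / 16 ∧
      Metric.closedBall 0 (3 * r) ⊆ Φ.target ∧
      (∀ z ∈ Metric.closedBall 0 (3 * r), ∀ u, ‖u‖ ≤ 2 * ‖chartFrame I Φ z u‖) ∧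
      (∀ z ∈ Metric.closedBall 0 r, ∀ u w,
        |chartMetric I Φ z u w - inner ℝ u w| ≤ C * r * ‖u‖ * ‖w‖) ∧
      ∀ z ∈ Metric.closedBall 0 r, ∀ z' ∈ Metric.closedBall 0 r, ∀ u w,
        |chartMetric I Φ z u w - chartMetric I Φ z' u w| ≤ C * ‖z - z'‖ * ‖u‖ * ‖w‖ := by
  obtain ⟨n, Φ, hΦ, h0, hiso⟩ := exists_chart_isometric_at_zero (I := I) (M := M)
  obtain ⟨C, R, hC, hR, hRt, hlip⟩ := exists_chartMetric_lipschitz hΦ h0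
  set k : ℝ := n + 1 with hk
  have hk1 : 1 ≤ k := by rw [hk]; linarith [(Nat.cast_nonneg n : (0 : ℝ) ≤ n)]
  obtain ⟨r, hr, hrR, hCr⟩ : ∃ r > 0, 3 * r ≤ R ∧ C * r * k ≤ 1 / 16 := by
    refine ⟨min (R / 3) (1 / (16 * (C + 1) * k)), by positivity, ?_, ?_⟩
    · linarith [min_le_left (R / 3) (1 / (16 * (C + 1) * k))]
    · calc C * min (R / 3) (1 / (16 * (C + 1) * k)) * k
          ≤ (C + 1) * (1 / (16 * (C + 1) * k)) * k := by
            gcongr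
            · linarith
            · exact min_le_right _ _
        _ = 1 / 16 := by field_simp
  have hCr' : C * r ≤ 1 / 16 := le_trans (le_mul_of_one_le_right (by positivity) hk1) hCr
  have hK0 : ∀ {ρ : ℝ}, ρ ≤ 3 * r → Metric.closedBall (0 : EuclideanSpace ℝ (Fin n)) ρ ⊆
      Metric.closedBall 0 R := fun hρ => Metric.closedBall_subset_closedBall (hρ.trans hrR)
  have hnear : ∀ {ρ : ℝ}, ρ ≤ 3 * r → ∀ z ∈ Metric.closedBall 0 ρ, ∀ u w,
      |chartMetric I Φ z u w - inner ℝ u w| ≤ C * ρ * ‖u‖ * ‖w‖ := fun {ρ} hρ z hz u w => by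
    have h := hlip z (hK0 hρ hz) 0 (Metric.mem_closedBall_self hR.le) u w
    rw [hiso, sub_zero] at h
    rw [mem_closedBall_zero_iff] at hz
    exact h.trans (by gcongr)
  exact ⟨n, Φ, C, r, hΦ, hC, hr, hCr, (hK0 le_rfl).trans hRt,
    fun z hz => norm_le_two_mul_norm_chartFrame (hnear le_rfl z hz) (by linarith),
    hnear (by linarith),
    fun z hz z' hz' => hlip z (hK0 (by linarith) hz) z' (hK0 (by linarith) hz')⟩

end Riemannian

/-! ### The Euclidean model of the arc of diffeomorphisms -/

lemma eventually_one_div_mul_le (X : ℝ) {η : ℝ} (hη : 0 < η) :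
    ∀ᶠ s : ℕ in Filter.atTop, 1 / (s : ℝ) * X ≤ η := by
  have h := (tendsto_one_div_atTop_nhds_zero_nat (𝕜 := ℝ)).mul_const X
  rw [zero_mul] at h
  exact (h.eventually_lt_const hη).mono fun _ h => h.le

/-- A smooth family of compactly supported perturbations of the identity of `V`, indexed by
`θ ∈ [-1, 1]`. All of its members have the same differential `1 - S` on the ball of radius `r` and
map that ball into its interior, and the two extreme members cover the closure of some open set
`U` by their images of `U` itself. The parameter `η` bounds the `C¹` size of the perturbation.
The real number `τ` measures the size of `S`; the perturbation moves points of the ball by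
`O(τ)`, with the explicit constants that the comparison of a Riemannian metric with the Euclidean
one requires: `k` bounds the distortion of `S`, and `C` is a Lipschitz constant of the metric. -/
structure ContractingFamily (V : Type*) [NormedAddCommGroup V] [InnerProductSpace ℝ V]
    (r k C η : ℝ) where
  /-- The maps of the family. -/
  F : ℝ → V → V
  /-- The defect from the identity of the differential on the ball. -/
  S : V →L[ℝ] V
  /-- The scale of `S`. -/
  τ : ℝ
  /-- The set covered by its two extreme images. -/
  U : Set V
  τ_pos : 0 < τ
  sq_mul_τ_le : k ^ 2 * τ ≤ 1 / 16
  norm_S_apply_le : ∀ u, ‖S u‖ ≤ k * τ * ‖u‖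
  le_inner_S : ∀ u, τ / 2 * ‖u‖ ^ 2 ≤ inner ℝ u (S u)
  norm_sub_S_le : ∀ u, ‖u - S u‖ ≤ ‖u‖
  contDiff_uncurry : ContDiff ℝ ∞ fun q : ℝ × V => F q.1 q.2
  exists_inverse : ∀ θ, |θ| ≤ 1 → ∃ G : V → V, ContDiff ℝ ∞ G ∧
    Function.LeftInverse G (F θ) ∧ Function.RightInverse G (F θ)
  eq_self : ∀ θ, ∀ z ∉ Metric.closedBall (0 : V) (3 * r), F θ z = z
  norm_sub_le : ∀ θ, |θ| ≤ 1 → ∀ z, ‖F θ z - z‖ ≤ η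
  norm_fderiv_sub_le : ∀ θ, |θ| ≤ 1 → ∀ z, ‖fderiv ℝ (F θ) z - .id ℝ V‖ ≤ η
  mem_ball : ∀ θ, |θ| ≤ 1 → ∀ z ∈ Metric.closedBall (0 : V) r, F θ z ∈ Metric.ball (0 : V) r
  mul_norm_sub_le : ∀ θ, |θ| ≤ 1 → ∀ z ∈ Metric.closedBall (0 : V) r,
    C * ‖F θ z - z‖ ≤ τ / 4
  fderiv_eq : ∀ θ, ∀ z ∈ Metric.closedBall (0 : V) r, fderiv ℝ (F θ) z = .id ℝ V - S
  isOpen_U : IsOpen U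
  isConnected_U : IsConnected U
  closure_U_subset : closure U ⊆ Metric.ball 0 r
  closure_U_subset_union : closure U ⊆ F (-1) '' U ∪ F 1 '' U

lemma nonempty_contractingFamily (n : ℕ) {r C η : ℝ} (hr : 0 < r) (hC : 0 ≤ C)
    (hCr : C * r * (n + 1) ≤ 1 / 16) (hη : 0 < η) :
    Nonempty (ContractingFamily (EuclideanSpace ℝ (Fin n)) r (n + 1) C η) := by
  set k : ℝ := n + 1 with hk
  have hk1 : 1 ≤ k := by rw [hk]; linarith [(Nat.cast_nonneg n : (0 : ℝ) ≤ n)]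
  obtain ⟨χ, B, hχ, h01, hB, hχB, hχ1, hχ0⟩ :=
    exists_smooth_cutoff (V := EuclideanSpace ℝ (Fin n)) hr
  -- The translation is taken of size at most `τ * c`.
  obtain ⟨c, hc, hcr, hCc⟩ : ∃ c > 0, c ≤ r / 4 ∧ C * c ≤ 1 / 16 := by
    refine ⟨min (r / 4) (1 / (16 * (C + 1))), by positivity, min_le_left _ _, ?_⟩
    calc C * min (r / 4) (1 / (16 * (C + 1))) ≤ (C + 1) * (1 / (16 * (C + 1))) := by
          gcongr
          · linarith
          · exact min_le_right _ _
      _ = 1 / 16 := by field_simp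
  obtain ⟨s, hs0, hcov, hsk, hs1, hs2, hs3⟩ :=
    ((Filter.eventually_gt_atTop 0).and <| (eventually_exists_covering n).and <|
      (eventually_one_div_mul_le (k ^ 2) (η := 1 / 16) (by norm_num)).and <|
      (eventually_one_div_mul_le (k * (3 * r) + c) hη).and <|
      (eventually_one_div_mul_le (B * (k * (3 * r) + c) + k) hη).and
      (eventually_one_div_mul_le (B * (k * (3 * r) + c) + k) (η := 1 / 2) (by norm_num))).exists
  set τ : ℝ := 1 / (s : ℝ) with hτdef
  have hτ : 0 < τ := by positivity
  have hτ1 : τ ≤ 1 := by nlinarith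
  obtain ⟨v, hv, U, hUo, hUc, hUρ, hU⟩ := hcov (τ * c) (by positivity)
  set D := expDiag n τ with hD
  set S : EuclideanSpace ℝ (Fin n) →L[ℝ] EuclideanSpace ℝ (Fin n) := .id ℝ _ - D with hS
  have hSapp : ∀ u, S u = u - D u := fun u => rfl
  have hSle : ∀ u, ‖S u‖ ≤ k * τ * ‖u‖ := fun u => by
    refine (norm_sub_expDiag_apply_le hτ.le u).trans ?_
    gcongr
    linarith
  have hSn : ‖S‖ ≤ τ * k := S.opNorm_le_bound (by positivity) fun u => by
    rw [mul_comm τ k]; exact hSle u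
  have hSge : ∀ u, τ / 2 * ‖u‖ ^ 2 ≤ inner ℝ u (S u) := fun u =>
    half_mul_norm_sq_le_inner_sub_expDiag hτ.le hτ1 u
  have hDle : ∀ u, ‖D u‖ ≤ ‖u‖ * Real.exp (-τ) := norm_expDiag_apply_le hτ.le
  have hDS : ∀ u, ‖u - S u‖ ≤ ‖u‖ := fun u => by
    rw [hSapp, sub_sub_cancel]
    exact (hDle u).trans (mul_le_of_le_one_right (norm_nonneg _)
      (Real.exp_le_one_iff.2 (by linarith)))
  have habs : |3 * r| = 3 * r := abs_of_pos (by positivity)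
  have hδ : ‖S‖ * |3 * r| + ‖v‖ ≤ τ * (k * (3 * r) + c) := by
    rw [habs]
    have : ‖S‖ * (3 * r) ≤ τ * k * (3 * r) := by gcongr
    linarith
  have hδ' : B * (‖S‖ * |3 * r| + ‖v‖) + ‖S‖ ≤ τ * (B * (k * (3 * r) + c) + k) := by
    have := mul_le_mul_of_nonneg_left hδ hB
    linarith
  have hFin : ∀ θ, ∀ z, ‖z‖ < 2 * r → cutoffMap χ S v θ z = D z + θ • v := fun θ z hz => by
    simp only [cutoffMap, hχ1 z hz, one_smul, hSapp]
    abel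
  have hθv : ∀ θ : ℝ, |θ| ≤ 1 → ‖θ • v‖ ≤ τ * c := fun θ hθ => by
    rw [norm_smul, Real.norm_eq_abs]
    exact (mul_le_of_le_one_left (norm_nonneg _) hθ).trans hv
  have hclU : closure U ⊆ Metric.ball 0 r := by
    refine (closure_mono hUρ).trans (Metric.closure_ball_subset_closedBall.trans ?_)
    refine Metric.closedBall_subset_ball ?_
    nlinarith
  exact ⟨{
    F := cutoffMap χ S v
    S := S
    τ := τ
    U := U
    τ_pos := hτ
    sq_mul_τ_le := by rwa [mul_comm]
    norm_S_apply_le := hSle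
    le_inner_S := hSge
    norm_sub_S_le := hDS
    contDiff_uncurry := contDiff_cutoffMap hχ S v
    exists_inverse := fun θ hθ =>
      exists_smooth_inverse_cutoffMap hχ h01 hB hχB hχ0 (hδ'.trans hs3) hθ
    eq_self := fun θ z hz => by
      rw [mem_closedBall_zero_iff, not_le] at hz
      simp only [cutoffMap, hχ0 z hz.le, zero_smul, add_zero]
    norm_sub_le := fun θ hθ z =>
      (norm_cutoffMap_sub_le h01 hχ0 S v hθ z).trans (hδ.trans hs1)
    norm_fderiv_sub_le := fun θ hθ z => by
      rw [fderiv_cutoffMap_sub_id hχ]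
      exact (norm_fderiv_cutoff_smul_le hχ h01 hB hχB hχ0 S v hθ z).trans (hδ'.trans hs2)
    mem_ball := fun θ hθ z hz => by
      rw [mem_closedBall_zero_iff] at hz
      rw [mem_ball_zero_iff, hFin θ z (by linarith)]
      have h1 : ‖D z‖ ≤ (1 - τ / 2) * r := by
        refine (hDle z).trans ?_
        rw [mul_comm]
        exact mul_le_mul (exp_neg_le_one_sub_half hτ.le hτ1) hz (norm_nonneg _) (by linarith)
      have h2 : τ * c ≤ τ * (r / 4) := by gcongr
      have h3 := norm_add_le (D z) (θ • v)
      have h4 := hθv θ hθ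
      linarith [mul_pos hτ hr]
    mul_norm_sub_le := fun θ hθ z hz => by
      rw [mem_closedBall_zero_iff] at hz
      have e1 : D z + θ • v - z = θ • v - S z := by rw [hSapp]; abel
      have e2 : ‖θ • v - S z‖ ≤ τ * c + k * τ * r :=
        (norm_sub_le _ _).trans (add_le_add (hθv θ hθ) ((hSle z).trans (by gcongr)))
      rw [hFin θ z (by linarith), e1]
      calc C * ‖θ • v - S z‖ ≤ C * (τ * c + k * τ * r) := by gcongr
        _ = τ * (C * c) + τ * (C * r * k) := by ring
        _ ≤ τ * (1 / 16) + τ * (1 / 16) := by gcongr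
        _ ≤ τ / 4 := by linarith
    fderiv_eq := fun θ z hz => by
      rw [mem_closedBall_zero_iff] at hz
      have heq : cutoffMap χ S v θ =ᶠ[𝓝 z] fun z => D z + θ • v := by
        filter_upwards [continuous_norm.continuousAt.eventually
          (gt_mem_nhds (show ‖z‖ < 2 * r by linarith))] with w hw using hFin θ w hw
      rw [heq.fderiv_eq, (D.hasFDerivAt.add_const _).fderiv, hS, sub_sub_cancel]
    isOpen_U := hUo
    isConnected_U := hUc
    closure_U_subset := hclU
    closure_U_subset_union := fun x hx => by
      obtain ⟨y, hy, hxy⟩ := hU x hx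
      have hyn : ‖y‖ < 2 * r := by
        have := mem_ball_zero_iff.1 (hclU (subset_closure hy))
        linarith
      refine hxy.symm.imp (fun h => ⟨y, hy, ?_⟩) (fun h => ⟨y, hy, ?_⟩)
      · rw [hFin _ y hyn, h, neg_one_smul, sub_eq_add_neg]
      · rw [hFin _ y hyn, h, one_smul] }⟩

/-! ### The arc of diffeomorphisms on the manifold -/

theorem theorem4
    {E : Type*} [NormedAddCommGroup E] [NormedSpace ℝ E] [FiniteDimensional ℝ E]
    {H : Type*} [TopologicalSpace H] (I : ModelWithCorners ℝ E H)
    {M : Type*} [TopologicalSpace M] [ChartedSpace H M] [IsManifold I ∞ M]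
    [T2Space M] [SigmaCompactSpace M] [Nonempty M]
    [RiemannianBundle (fun x : M => TangentSpace I x)]
    [IsContMDiffRiemannianBundle I ∞ E (fun x : M => TangentSpace I x)] :
    ∃ Ahat : Set M, IsRegion Ahat ∧ IsCompact Ahat ∧
      ∀ (N : ℕ) (e : M → EuclideanSpace ℝ (Fin N)), IsEuclideanEmbedding I e →
      ∀ ε : ℝ, 0 < ε →
        ∃ f : unitInterval → (M ≃ₘ^∞⟮I, I⟯ M),
          ContMDiff ((𝓡∂ 1).prod I) I ∞ (fun p : unitInterval × M => f p.1 p.2) ∧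
          (∀ t : unitInterval, StrictlyInside (f t '' Ahat) Ahat) ∧
          (∀ t : unitInterval, ∀ x ∈ Ahat, ‖mfderiv I I (f t) x‖ < 1) ∧
          (∀ t : unitInterval, c1Dist I e (f t) id < ENNReal.ofReal ε) ∧
          ∃ A : Set M, IsRegion A ∧ StrictlyInside A Ahat ∧
            StrictlyInside A (f 0 '' A ∪ f 1 '' A) := by
  obtain ⟨n, Φ, C, r, hΦ, hC, hr, hCr, hKt, hKn, hnear, hlip⟩ :=
    exists_chart_with_metric_bounds (I := I) (M := M)
  have hk1 : (1 : ℝ) ≤ n + 1 := by linarith [(Nat.cast_nonneg n : (0 : ℝ) ≤ n)]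
  have hK := isCompact_closedBall (0 : EuclideanSpace ℝ (Fin n)) (3 * r)
  have hrt : Metric.closedBall 0 r ⊆ Φ.target :=
    (Metric.closedBall_subset_closedBall (by linarith)).trans hKt
  have hbt : Metric.ball 0 r ⊆ Φ.target := Metric.ball_subset_closedBall.trans hrt
  have hclr : closure (Metric.ball (0 : EuclideanSpace ℝ (Fin n)) r) = Metric.closedBall 0 r :=
    closure_ball 0 hr.ne'
  have hint : Φ.symm '' Metric.ball 0 r ⊆ interior (Φ.symm '' Metric.closedBall 0 r) :=
    interior_maximal (image_mono Metric.ball_subset_closedBall)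
      (Φ.symm.isOpen_image_of_subset_source Metric.isOpen_ball hbt)
  refine ⟨Φ.symm '' Metric.closedBall 0 r, ?_,
    (isCompact_closedBall _ _).image_of_continuousOn (Φ.continuousOn_symm.mono hrt), ?_⟩
  · rw [← hclr]
    refine isRegion_symm_image_closure Metric.isOpen_ball
      ⟨⟨0, Metric.mem_ball_self hr⟩, (convex_ball _ _).isPreconnected⟩ ?_ (by rwa [hclr])
    rw [hclr]
    exact isCompact_closedBall _ _
  intro N e he ε hε
  obtain ⟨η, hη, hη'⟩ := exists_c1Dist_transplant_lt hΦ hK hKt hKn he.contMDiff hε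
  obtain ⟨c⟩ := nonempty_contractingFamily n hr hC hCr hη
  -- The unit interval is rescaled to `[-1, 1]`.
  set θ : unitInterval → ℝ := fun t => 2 * (t : ℝ) - 1 with hθdef
  have hθ : ∀ t, |θ t| ≤ 1 := fun t => by
    have h1 := t.2.1
    have h2 := t.2.2
    rw [abs_le]
    constructor <;> simp only [hθdef] <;> linarith
  choose G hG hGF hFG using fun t : unitInterval => c.exists_inverse (θ t) (hθ t)
  have hFsmooth : ∀ t : unitInterval, ContDiff ℝ ∞ (c.F (θ t)) := fun t =>
    c.contDiff_uncurry.comp (contDiff_const.prodMk contDiff_id)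
  have hFt : ∀ t : unitInterval, MapsTo (c.F (θ t)) Φ.target Φ.target := fun t =>
    mapsTo_target_of_eq_id hKt (c.eq_self (θ t)) (hGF t).injective
  let f : unitInterval → (M ≃ₘ^∞⟮I, I⟯ M) := fun t =>
    transplantDiffeomorph hΦ hK hKt (hFsmooth t) (hG t) (c.eq_self (θ t)) (hGF t) (hFG t)
  have hfs : ∀ t, ∀ z ∈ Φ.target, f t (Φ.symm z) = Φ.symm (c.F (θ t) z) := fun t z hz =>
    transplant_symm (c.F (θ t)) hz
  have hUt : closure c.U ⊆ Φ.target := c.closure_U_subset.trans hbt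
  refine ⟨f, ?_, ?_, ?_, ?_, Φ.symm '' closure c.U, ?_, ?_, ?_⟩
  · refine contMDiff_transplant (J := 𝓡∂ 1) hΦ hK hKt (F := fun t => c.F (θ t)) ?_
      (fun t => c.eq_self (θ t)) hFt
    have hθs : ContMDiff ((𝓡∂ 1).prod 𝓘(ℝ, EuclideanSpace ℝ (Fin n))) 𝓘(ℝ, ℝ) ∞
        fun q : unitInterval × EuclideanSpace ℝ (Fin n) => θ q.1 :=
      ((contDiff_const.mul contDiff_id).sub contDiff_const : ContDiff ℝ ∞
        fun x : ℝ => 2 * x - 1).contMDiff.comp (contMDiff_subtypeVal_Icc.comp contMDiff_fst)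
    exact c.contDiff_uncurry.contMDiff.comp (hθs.prodMk_space contMDiff_snd)
  · rintro t _ ⟨_, ⟨z, hz, rfl⟩, rfl⟩
    rw [hfs t z (hrt hz)]
    exact hint ⟨_, c.mem_ball _ (hθ t) z hz, rfl⟩
  · rintro t _ ⟨z, hz, rfl⟩
    have hFz := Metric.ball_subset_closedBall (c.mem_ball _ (hθ t) z hz)
    exact norm_mfderiv_transplant_lt_one hΦ ((hFsmooth t).differentiable (by simp))
      ((f t).contMDiff_toFun.mdifferentiable (by simp)) hk1 c.τ_pos (α := C * r)
      (by positivity) c.norm_S_apply_le c.le_inner_S c.norm_sub_S_le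
      (hrt hz) (hrt hFz) (c.fderiv_eq _ z hz) (hnear z hz) (hlip _ hFz _ hz) hCr
      c.sq_mul_τ_le (c.mul_norm_sub_le _ (hθ t) z hz)
  · exact fun t => hη' _ (hFsmooth t) (hGF t).injective (c.eq_self (θ t))
      (c.norm_sub_le _ (hθ t)) (c.norm_fderiv_sub_le _ (hθ t))
  · exact isRegion_symm_image_closure c.isOpen_U c.isConnected_U
      ((isCompact_closedBall 0 r).of_isClosed_subset isClosed_closure
        (c.closure_U_subset.trans Metric.ball_subset_closedBall)) hUt
  · exact (image_mono c.closure_U_subset).trans hint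
  · have hopen : ∀ t, f t '' (Φ.symm '' c.U) ⊆ interior (f t '' (Φ.symm '' closure c.U)) :=
      fun t => interior_maximal (image_mono (image_mono subset_closure))
        ((f t).toHomeomorph.isOpenMap _
          (Φ.symm.isOpen_image_of_subset_source c.isOpen_U (subset_closure.trans hUt)))
    have h0 : θ 0 = -1 := by simp [hθdef]
    have h1 : θ 1 = 1 := by simp [hθdef]; norm_num
    rintro _ ⟨x, hx, rfl⟩
    rcases c.closure_U_subset_union hx with ⟨y, hy, rfl⟩ | ⟨y, hy, rfl⟩
    · refine interior_mono subset_union_left (hopen 0 ⟨_, ⟨y, hy, rfl⟩, ?_⟩)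
      rw [hfs 0 y (hUt (subset_closure hy)), h0]
    · refine interior_mono subset_union_right (hopen 1 ⟨_, ⟨y, hy, rfl⟩, ?_⟩)
      rw [hfs 1 y (hUt (subset_closure hy)), h1]
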